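/- **Setting.** Let $\mathcal S,\mathcal A$ be finite sets ($\mathcal A\neq\emptyset$), $\lambda:\mathcal S\times\mathcal A\to\mathcal S$ the transition map and $r:\mathcal S\times\mathcal A\to\mathbb R$ the reward of a deterministic undiscounted MDP with an absorbing state $s_\infty$ ($\lambda(s_\infty,a)=s_\infty$, $r(s_\infty,a)=0$) and a partition $\mathcal S=\mathcal S_0\sqcup\dots\sqcup\mathcal S_d\sqcup\{s_\infty\}$ such that $\lambda(s,a)\in\mathcal S_{l+1}\sqcup\dots\sqcup\mathcal S_d\sqcup\{s_\infty\}$ for $s\in\mathcal S_l$ (for example the MDP of a combinatorial optimization problem). Let $BV(s)=\max_a\{r(s,a)+V(\lambda(s,a))\}$ be the Bellman map on $\mathcal V^0=\{V:\mathcal S\to\mathbb R\mid V(s_\infty)=0\}$ and $V^*$ the optimal value function. Let $\tau_0>\tau_1>\dots>\tau_d>\tau_\infty=:\tau_{d+1}>0$, $\gamma^\tau=\max_{0\le l\le d}\tau_{l+1}/\tau_l<1$, $\tau(s)=\tau_l$ for $s\in\mathcal S_l$, $\tau(s_\infty)=\tau_\infty$, and $\|V\|_\tau=\max_s|V(s)|/\tau(s)$.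 Let $\sigma$ be a probability distribution on $\mathcal S$ with support $\mathcal S\setminus\{s_\infty\}$, $\|V\|_\sigma^2=\mathbb E_\sigma[V(s)^2]$ and $c(\sigma,\tau)=\min_{s\in\operatorname{supp}\sigma}\tau(s)\sqrt{\sigma(s)}$. Put $$\rho=\frac{R\sqrt W\,\gamma^\tau}{1-\gamma^\tau}\Big(\frac1{\tau_\infty}-\frac1{\tau_0}\Big),\qquad R=\max_{s,a}r(s,a),\quad W=\max_l|\mathcal S_l| .$$ Let $\Theta\subset\mathbb R^N$ be non-empty, compact and convex with diameter $D_\Theta$, let $\phi:\mathcal S\setminus\{s_\infty\}\to\mathbb R^K$, and let $v$ be a real function that is continuous on $\mathbb R^K\times\Theta$. Put $V_\theta(s)=v(\phi(s),\theta)$ for $s\ne s_\infty$, $V_\theta(s_\infty)=0$, and $\mathcal V_\Theta=\{V_\theta\mid\theta\in\Theta\}$. Assume $|V_\theta(s)-V_{\theta'}(s)|\le L(s)\|\theta-\theta'\|$ for $\theta,\theta'\in\Theta$, where $L\geq0$, $L(s_\infty)=0$, and that $\mathcal V_\Theta$ is convex. Let $\Pi$ be the $\|\cdot\|_\sigma$-projection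 onto $\mathcal V_\Theta$ and assume that $\Pi B$ is a contraction of $\mathcal V^0$ of modulus $\gamma\in[0,1)$ for $\|\cdot\|_\tau$. Assume that for all $\tilde\theta\in\Theta$ and $s\in\mathcal S$ the function $f_{\tilde\theta}(\cdot,s)=(BV_{\tilde\theta}(s)-V_{(\cdot)}(s))^2$ is convex on $\Theta$ and differentiable at every point of $\Theta$, with a gradient that is $M$-Lipschitz on $\Theta$, where $M$ does not depend on $\tilde\theta,s$. Let $\nu>0$ be such that, for all sufficiently small $r>0$ with $r<D_\Theta$, $\Theta$ has an $r$-net of at most $(\nu D_\Theta/r)^N$ points. **Algorithm (FVI).** Start at $\tilde\theta_0\in\Theta$ with $\|V_{\tilde\theta_0}\|_\tau\le\rho$. For $t=0,\dots,T-1$: draw fresh i.i.d. samples $s_1,\dots,s_{n_t}\sim\sigma$, and let $\tilde\theta_{t+1}$ be obtained from $\tilde\theta_t$ by $c_t$ steps of projected gradient descent on $\Theta$, with stepsize $\eta$, for $\frac1{n_t}\sum_{i=1}^{n_t}f_{\tilde\theta_t}(\cdot,s_i)$. Output $V_{\tilde\theta_T}$. **Constants.** Let $$\zeta_\kappa=2\Big[\Big(1+\frac{\tau_0\gamma^\tau}{\tau_d}\Big)\|L\|_\infty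 D_\Theta+\frac{\tau_0\gamma(1+\gamma^\tau)}{1-\gamma}\|V^*-\Pi V^*\|_\tau\Big],$$ $\kappa^*=\zeta_\kappa\|L\|_\infty$, $\hat\kappa=\kappa^*+\delta'$ with $\delta'>0$, $\omega=\zeta_\kappa D_\Theta(\|L\|_\infty+\mathbb E_\sigma[L(s)])$. Let $\eta>0$ with $\eta\kappa^*\le1$ and $\eta M\le 1$, let $0<\epsilon_0<1/4$, $\delta>0$, $\epsilon_t=\epsilon_0/(1+\delta)^t$, and $$\gamma^*=\max\Big\{\gamma,\frac1{\sqrt{1+\delta}}\Big\},\quad a=-\frac{2}{\log_{1+\delta}\gamma^*},\quad \rho'=\frac{\sqrt{\epsilon_0}}{1-\gamma}\Big(2\|L\|_\tau D_\Theta+\frac1{c(\sigma,\tau)}\Big),\quad T=\Big\lceil a\log_{1+\delta}\frac{\rho+\rho'}{\epsilon}\Big\rceil ,$$ $$\underline n_t=\max\Big\{\frac{32\omega^2}{\epsilon_t^2}\Big[N\ln\frac{16\nu D_\Theta\hat\kappa}{\epsilon_t}+\frac12\ln\frac1{\epsilon_t}\Big],0\Big\},\qquad \underline c_t=\frac{D_\Theta^2}{\eta\epsilon_t}.$$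 **Claim.** One has $\gamma^*<1$ and $a>0$; projected value iteration $V_{\theta_{t+1}}=\Pi BV_{\theta_t}$ converges from every $V_{\theta_0}\in\mathcal V_\Theta$ to one and the same $\tilde V^*\in\mathcal V_\Theta$; and for all sufficiently small $\epsilon>0$ (with a threshold that does not depend on $\tilde\theta_0$, $n_t$, $c_t$) the following holds. If $n_t\ge1$, $n_t\ge\underline n_t$ and $c_t\ge\underline c_t$ for all $t<T$, then FVI outputs an $\epsilon$-approximation of $\tilde V^*$ in expectation, $$\mathbb E\big[\|V_{\tilde\theta_T}-\tilde V^*\|_\tau\big]<\epsilon .$$ If moreover $n_t\le\underline n_t+1$ for all $t<T$, then the sample complexity is $$\sum_{t=0}^{T-1}n_t=O\Big(\log_{1+\delta}\Big(\frac1\epsilon\Big)\Big(\frac1\epsilon\Big)^{2a}\Big),$$ and if moreover $c_t\le\underline c_t+1$ for all $t<T$, then the number of projected gradient steps is $$\sum_{t=0}^{T-1}c_t=O\Big(\Big(\frac1\epsilon\Big)^{a}\Big),$$ where the implied constants do not depend on $\epsilon$, $\tilde\theta_0$, $n_t$, $c_t$. -/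

import Mathlib

open MeasureTheory ProbabilityTheory Filter Topology
open scoped Gradient

noncomputable section

namespace FVI

/-- A finite deterministic MDP with an absorbing, reward-free state `sinf` and a partition of the
other states into levels `0, …, depth` along which every transition goes strictly upwards (or to
`sinf`). The absorbing state carries the index `depth + 1`. -/
structure DetMDP (S A : Type*) where
  next : S → A → S
  reward : S → A → ℝ
  sinf : S
  depth : ℕ
  level : S → ℕ
  next_sinf : ∀ a, next sinf a = sinf
  reward_sinf : ∀ a, reward sinf a = 0
  level_sinf : level sinf = depth + 1
  level_le : ∀ s, s ≠ sinf → level s ≤ depth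
  level_next : ∀ s, s ≠ sinf → ∀ a, level s < level (next s a)

namespace DetMDP

variable {S A : Type*} (m : DetMDP S A)

/-- The undiscounted Bellman map. -/
def bellman (V : S → ℝ) (s : S) : ℝ := ⨆ a, (m.reward s a + V (m.next s a))

/-- The state reached from `s` along a string of actions. -/
def run (s : S) : List A → S
  | [] => s
  | a :: x => run (m.next s a) x

/-- The total reward collected from `s` along a string of actions. -/
def totalReward (s : S) : List A → ℝ
  | [] => 0
  | a :: x => m.reward s a + totalReward (m.next s a) x

/-- The optimal value function: the best total reward of a string leading to the absorbing state
(only finitely many values occur, since no reward is collected in the absorbing state). -/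
def optValue (s : S) : ℝ := sSup {h | ∃ x : List A, m.run s x = m.sinf ∧ h = m.totalReward s x}

/-- The maximal reward `R`. -/
def maxReward : ℝ := ⨆ p : S × A, m.reward p.1 p.2

/-- The maximal girth `W`: the largest number of states in one level. -/
def girth : ℝ := ⨆ l : Fin (m.depth + 1), ({s | m.level s = (l : ℕ)}.ncard : ℝ)

end DetMDP

/-- The data of fitted value iteration: the MDP, the sequence `tau 0, …, tau depth, tau (depth+1)`
(the last entry is `τ_∞`), the sampling distribution, the embedding `phi` of the states (its value
at the absorbing state is irrelevant), the parametrised function `v`, the parameter set, and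
the Lipschitz constants `lip s`. -/
structure Problem (S A : Type*) (K N : ℕ) where
  mdp : DetMDP S A
  tau : ℕ → ℝ
  sigma : S → ℝ
  phi : S → EuclideanSpace ℝ (Fin K)
  v : EuclideanSpace ℝ (Fin K) → EuclideanSpace ℝ (Fin N) → ℝ
  Theta : Set (EuclideanSpace ℝ (Fin N))
  lip : S → ℝ

/-- A nearest point of `C` to `x`, if there is one. -/
def projPoint {E : Type*} [MetricSpace E] (C : Set E) (x : E) : E :=
  open Classical in
  if h : ∃ y ∈ C, ∀ z ∈ C, dist x y ≤ dist x z then h.choose else x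

namespace Problem

variable {S A : Type*} {K N : ℕ} (P : Problem S A K N)

/-- The value function `V_θ`, which vanishes at the absorbing state. -/
def value (θ : EuclideanSpace ℝ (Fin N)) (s : S) : ℝ :=
  open Classical in if s = P.mdp.sinf then 0 else P.v (P.phi s) θ

/-- The set `𝒱_Θ` of value functions of the scheme. -/
def values : Set (S → ℝ) := P.value '' P.Theta

/-- The weight `τ(s)`. -/
def weight (s : S) : ℝ := P.tau (P.mdp.level s)

/-- The `τ`-weighted sup norm. -/
def tnorm (V : S → ℝ) : ℝ := ⨆ s, |V s| / P.weight s

/-- The diameter of `Θ`. -/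
def diam : ℝ := Metric.diam P.Theta

/-- The sup norm of `L`. -/
def lipSup : ℝ := ⨆ s, P.lip s

/-- The contraction modulus `γ^τ` of the weights. -/
def gammaTau : ℝ := ⨆ l : Fin (P.mdp.depth + 1), P.tau (l + 1) / P.tau l

/-- The constant `c(σ,τ)`. -/
def cSigmaTau : ℝ := ⨅ s : {s // 0 < P.sigma s}, P.weight s.1 * √(P.sigma s.1)

/-- The radius `ρ`. -/
def rho : ℝ :=
  P.mdp.maxReward * √P.mdp.girth * P.gammaTau / (1 - P.gammaTau) *
    (1 / P.tau (P.mdp.depth + 1) - 1 / P.tau 0)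

section Expectation

variable [Fintype S]

/-- The `σ`-weighted `ℓ₂` norm. -/
def snorm (V : S → ℝ) : ℝ := √(∑ s, P.sigma s * V s ^ 2)

/-- The `σ`-projection onto `𝒱_Θ`: a `σ`-nearest `V_θ` to `V`. -/
def proj (V : S → ℝ) : S → ℝ :=
  open Classical in
  if h : ∃ θ ∈ P.Theta, ∀ θ' ∈ P.Theta,
      P.snorm (P.value θ - V) ≤ P.snorm (P.value θ' - V)
  then P.value h.choose else 0

/-- The `σ`-projected Bellman map. -/
def projBellman (V : S → ℝ) : S → ℝ := P.proj (P.mdp.bellman V)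

/-- `Vt` is the limit of projected value iteration, whatever its initialisation in `𝒱_Θ`. -/
def IsPVILimit (Vt : S → ℝ) : Prop :=
  Vt ∈ P.values ∧
    ∀ θ ∈ P.Theta, Tendsto (fun t : ℕ => P.projBellman^[t] (P.value θ)) atTop (𝓝 Vt)

end Expectation

/-- The sample function `f(θ, s) = (B V_{θ₀}(s) - V_θ(s))²` at the current iterate `θ₀`. -/
def sampleLoss (θ₀ θ : EuclideanSpace ℝ (Fin N)) (s : S) : ℝ :=
  (P.mdp.bellman (P.value θ₀) s - P.value θ s) ^ 2

/-- The sample average of the loss over the samples `x 0, …, x (n-1)`. -/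
def empLoss (θ₀ : EuclideanSpace ℝ (Fin N)) (n : ℕ) (x : ℕ → S)
    (θ : EuclideanSpace ℝ (Fin N)) : ℝ :=
  (1 / (n : ℝ)) * ∑ i ∈ Finset.range n, P.sampleLoss θ₀ θ (x i)

/-- One step of projected gradient descent on the sample average, with stepsize `η`. -/
def pgdStep (η : ℝ) (θ₀ : EuclideanSpace ℝ (Fin N)) (n : ℕ) (x : ℕ → S)
    (θ : EuclideanSpace ℝ (Fin N)) : EuclideanSpace ℝ (Fin N) :=
  projPoint P.Theta (θ - η • ∇ (P.empLoss θ₀ n x) θ)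

/-- The parameter iterates of fitted value iteration: iteration `t` uses the samples
`x t 0, …, x t (n t - 1)` and `c t` projected gradient steps started at the current iterate. -/
def iterate (η : ℝ) (n c : ℕ → ℕ) (x : ℕ → ℕ → S) (θ₀ : EuclideanSpace ℝ (Fin N)) :
    ℕ → EuclideanSpace ℝ (Fin N)
  | 0 => θ₀
  | t + 1 =>
      let θ := iterate η n c x θ₀ t
      (P.pgdStep η θ (n t) (x t))^[c t] θ

/-- The standing assumptions, with `γ` the contraction modulus of the projected Bellman map and
`M` a Lipschitz constant of the gradients of the sample functions on `Θ`. -/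
structure Standing [Fintype S] (γ M : ℝ) : Prop where
  tau_pos : ∀ l ≤ P.mdp.depth + 1, 0 < P.tau l
  tau_lt : ∀ l ≤ P.mdp.depth, P.tau (l + 1) < P.tau l
  sigma_mem : P.sigma ∈ stdSimplex ℝ S
  sigma_supp : ∀ s, 0 < P.sigma s ↔ s ≠ P.mdp.sinf
  theta_nonempty : P.Theta.Nonempty
  theta_compact : IsCompact P.Theta
  theta_convex : Convex ℝ P.Theta
  v_continuous : ContinuousOn (Function.uncurry P.v) (Set.univ ×ˢ P.Theta)
  lip_nonneg : ∀ s, 0 ≤ P.lip s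
  lip_sinf : P.lip P.mdp.sinf = 0
  value_lip : ∀ s, ∀ θ ∈ P.Theta, ∀ θ' ∈ P.Theta,
    |P.value θ s - P.value θ' s| ≤ P.lip s * dist θ θ'
  gamma_nonneg : 0 ≤ γ
  gamma_lt_one : γ < 1
  contraction : ∀ V V' : S → ℝ, V P.mdp.sinf = 0 → V' P.mdp.sinf = 0 →
    P.tnorm (P.projBellman V - P.projBellman V') ≤ γ * P.tnorm (V - V')
  values_convex : Convex ℝ P.values
  loss_convex : ∀ θ₀ ∈ P.Theta, ∀ s, ConvexOn ℝ P.Theta (fun θ => P.sampleLoss θ₀ θ s)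
  loss_differentiable : ∀ θ₀ ∈ P.Theta, ∀ s, ∀ θ ∈ P.Theta,
    DifferentiableAt ℝ (fun θ => P.sampleLoss θ₀ θ s) θ
  loss_gradient_lip : ∀ θ₀ ∈ P.Theta, ∀ s, ∀ θ ∈ P.Theta, ∀ θ' ∈ P.Theta,
    ‖∇ (fun θ => P.sampleLoss θ₀ θ s) θ - ∇ (fun θ => P.sampleLoss θ₀ θ s) θ'‖ ≤ M * dist θ θ'

/-- `ν` is a covering constant of `Θ`: for all small scales `r` (below the diameter), `Θ` has an
`r`-net with at most `(ν D_Θ / r)^N` points. -/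
def IsCoveringConst (ν : ℝ) : Prop :=
  0 < ν ∧ ∀ᶠ r in 𝓝[>] (0 : ℝ), r < P.diam →
    ∃ F : Finset (EuclideanSpace ℝ (Fin N)), (F : Set (EuclideanSpace ℝ (Fin N))) ⊆ P.Theta ∧
      (∀ θ ∈ P.Theta, ∃ θ' ∈ F, dist θ θ' ≤ r) ∧ (F.card : ℝ) ≤ (ν * P.diam / r) ^ N

section Constants

variable [Fintype S]

/-- The constant `ζ_κ`. -/
def zeta (γ : ℝ) : ℝ :=
  2 * ((1 + P.tau 0 * P.gammaTau / P.tau P.mdp.depth) * P.lipSup * P.diam +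
    P.tau 0 * γ * (1 + P.gammaTau) / (1 - γ) *
      P.tnorm (P.mdp.optValue - P.proj P.mdp.optValue))

/-- The constant `κ* = ζ_κ ‖L‖_∞`. -/
def kappaStar (γ : ℝ) : ℝ := P.zeta γ * P.lipSup

/-- The constant `ω = ζ_κ D_Θ (‖L‖_∞ + 𝔼_σ L)`. -/
def omega (γ : ℝ) : ℝ :=
  P.zeta γ * P.diam * (P.lipSup + ∑ s, P.sigma s * P.lip s)

/-- The constant `ρ'`. -/
def rho' (γ ε₀ : ℝ) : ℝ :=
  √ε₀ / (1 - γ) * (2 * P.tnorm P.lip * P.diam + 1 / P.cSigmaTau)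

/-- The lower bound on the number of samples at accuracy `e`, where `κ̂ = κ* + δ'`. The second
entry of the maximum is `0` because `β = ∞` for this `κ̂`. -/
def sampleBound (γ ν δ' e : ℝ) : ℝ :=
  max (32 * P.omega γ ^ 2 / e ^ 2 *
    (N * Real.log (16 * ν * P.diam * (P.kappaStar γ + δ') / e) + 1 / 2 * Real.log (1 / e))) 0

end Constants

/-- The lower bound on the number of projected gradient steps at accuracy `e`. -/
def stepBound (η e : ℝ) : ℝ := P.diam ^ 2 / (η * e)

end Problem

/-- The accuracies `ε_t = ε₀ / (1 + δ)^t`. -/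
def acc (ε₀ δ : ℝ) (t : ℕ) : ℝ := ε₀ / (1 + δ) ^ t

/-- The rate `γ* = max {γ, 1/√(1+δ)}`. -/
def gammaStar (γ δ : ℝ) : ℝ := max γ (1 / √(1 + δ))

/-- The exponent `a = -2 / log_{1+δ} γ*`. -/
def expo (γ δ : ℝ) : ℝ := -(2 / Real.logb (1 + δ) (gammaStar γ δ))

/-- The number of iterations `T`. -/
def Problem.numIter {S A : Type*} {K N : ℕ} [Fintype S] (P : Problem S A K N)
    (γ ε₀ δ ε : ℝ) : ℕ :=
  ⌈expo γ δ * Real.logb (1 + δ) ((P.rho + P.rho' γ ε₀) / ε)⌉₊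

/-- The variables `X t i` are i.i.d. with distribution `σ`. -/
structure IsIIDSample {S Ω : Type*} [MeasurableSpace S] [MeasurableSpace Ω] (σ : S → ℝ)
    (μ : Measure Ω) (X : ℕ → ℕ → Ω → S) : Prop where
  measurable : ∀ t i, Measurable (X t i)
  indep : iIndepFun (fun p : ℕ × ℕ => X p.1 p.2) μ
  law : ∀ t i s, μ.real (X t i ⁻¹' {s}) = σ s

end FVI

end

namespace FVI

/-! ### Projected gradient descent -/

/-! The proof tracks the expected `τ`-distance `E_t` of the `t`-th iterate from the fixed point of
`projBellman` and shows `E_{t+1} ≤ γ E_t + C √ε_t`.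

The error of one iteration has two sources. Projected gradient descent minimises the empirical loss
up to `ε_t / 2` (`projected_gradient_iterate`, `Standing.empLoss_iterate_pgdStep`). Since `S` is
finite, empirical and true loss differ only through the frequencies of the states. Excess losses
therefore differ by at most a constant times the `ℓ₁`-deviation of these frequencies from `σ`,
uniformly in `θ`, and a variance bound makes this `O(ε_t)` in mean
(`IsIIDSample.integral_freq_sub_sq_le`, `Standing.exists_lip_div_le`). Convexity of `values` turns
excess loss into squared distance to the projection (`Standing.snorm_sub_proj_sq_add_le`), so the
one-step error is of order `√ε_t`.

As `γ ≤ γ*` and `√ε_t ≤ √ε₀ γ*^t`, the recursion gives `E_T ≤ γ*^T (U + C T)`. The factor 2 in the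
exponent `a` makes `γ*^T` quadratic in `ε`, and the spare power of `ε` absorbs both the constants
and the logarithmic factor `T` once `ε` is small. The complexity bounds are geometric sums dominated
by their last terms, of sizes `(1+δ)^{2T}` and `(1+δ)^T`. -/

theorem projPoint_spec {E : Type*} [MetricSpace E] {C : Set E} (hC : IsCompact C) (hne : C.Nonempty) (x : E) :
    projPoint C x ∈ C ∧ ∀ z ∈ C, dist x (projPoint C x) ≤ dist x z := by
  have h : ∃ y ∈ C, ∀ z ∈ C, dist x y ≤ dist x z :=
    hC.exists_isMinOn hne (continuous_const.dist continuous_id).continuousOn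
  rw [projPoint, dif_pos h]
  exact h.choose_spec

section Descent

variable {E : Type*} [NormedAddCommGroup E] [InnerProductSpace ℝ E]

theorem inner_sub_projPoint_nonpos {C : Set E} (hC : IsCompact C) (hconv : Convex ℝ C)
    (x : E) {z : E} (hz : z ∈ C) : inner ℝ (x - projPoint C x) (z - projPoint C x) ≤ 0 := by
  obtain ⟨hmem, hmin⟩ := projPoint_spec hC ⟨z, hz⟩ x
  refine (norm_eq_iInf_iff_real_inner_le_zero hconv hmem).1 ?_ z hz
  have : Nonempty C := ⟨⟨z, hz⟩⟩
  refine le_antisymm (le_ciInf fun w => ?_) (ciInf_le ⟨0, ?_⟩ (⟨_, hmem⟩ : C))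
  · simpa only [dist_eq_norm] using hmin w w.2
  · rintro _ ⟨w, rfl⟩
    exact norm_nonneg _

variable [CompleteSpace E] {C : Set E} {g : E → ℝ}

theorem hasDerivAt_comp_segment {x d : E} {t : ℝ} (h : DifferentiableAt ℝ g (x + t • d)) :
    HasDerivAt (fun u : ℝ => g (x + u • d)) (inner ℝ (∇ g (x + t • d)) d) t := by
  have h1 : HasDerivAt (fun u : ℝ => x + u • d) d t := by
    simpa using ((hasDerivAt_id t).smul_const d).const_add x
  have h2 := h.hasFDerivAt.comp_hasDerivAt t h1
  rw [inner_gradient_left]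
  exact h2

/-- On the segment from `x` to `z` this is one-variable convexity: the slope of the chord dominates
the derivative at the left endpoint. -/
theorem add_inner_gradient_le (hg : ConvexOn ℝ C g) {x z : E} (hx : x ∈ C) (hz : z ∈ C)
    (hd : DifferentiableAt ℝ g x) : g x + inner ℝ (∇ g x) (z - x) ≤ g z := by
  have hconv : ConvexOn ℝ (Set.Icc (0 : ℝ) 1) fun u : ℝ => g (x + u • (z - x)) := by
    have h := hg.comp_affineMap (AffineMap.lineMap x z)
    refine (h.subset ?_ (convex_Icc 0 1)).congr ?_
    · intro u hu
      exact hg.1.lineMap_mem hx hz hu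
    · intro u _
      simp [AffineMap.lineMap_apply, add_comm]
  have hder := hasDerivAt_comp_segment (g := g) (x := x) (d := z - x) (t := 0) (by simpa using hd)
  have := hconv.le_slope_of_hasDerivAt (by simp) (by simp) zero_lt_one hder
  simp only [slope_def_field, one_smul, zero_smul, add_zero, sub_zero, div_one,
    add_sub_cancel] at this
  linarith

/-- The descent lemma. The Lipschitz bound is available only on `C`, so the argument stays on the
segment, and monotonicity replaces integration of the gradient. -/
theorem le_add_inner_gradient {K : ℝ} (hC : Convex ℝ C) (hd : ∀ x ∈ C, DifferentiableAt ℝ g x)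
    (hl : ∀ x ∈ C, ∀ y ∈ C, ‖∇ g x - ∇ g y‖ ≤ K * dist x y) {x y : E} (hx : x ∈ C)
    (hy : y ∈ C) : g y ≤ g x + inner ℝ (∇ g x) (y - x) + K / 2 * ‖y - x‖ ^ 2 := by
  set d := y - x with hdd
  have hmem : ∀ u ∈ Set.Icc (0 : ℝ) 1, x + u • d ∈ C := fun u hu => hC.add_smul_sub_mem hx hy hu
  -- `g` along the segment minus its quadratic upper model, up to the constant `g x`. The Lipschitz
  -- bound makes the derivative nonpositive.
  let h : ℝ → ℝ := fun u => g (x + u • d) - u * inner ℝ (∇ g x) d - u ^ 2 * (K / 2 * ‖d‖ ^ 2)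
  have hder : ∀ u ∈ Set.Icc (0 : ℝ) 1, HasDerivAt h
      (inner ℝ (∇ g (x + u • d)) d - inner ℝ (∇ g x) d - u * K * ‖d‖ ^ 2) u := by
    intro u hu
    have h1 := hasDerivAt_comp_segment (hd _ (hmem u hu))
    have h2 := (h1.sub ((hasDerivAt_id u).mul_const (inner ℝ (∇ g x) d))).sub
      ((hasDerivAt_pow 2 u).mul_const (K / 2 * ‖d‖ ^ 2))
    refine h2.congr_deriv ?_
    simp
    ring
  have hanti : AntitoneOn h (Set.Icc 0 1) := by
    refine antitoneOn_of_deriv_nonpos (convex_Icc 0 1)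
      (fun u hu => (hder u hu).continuousAt.continuousWithinAt) ?_ ?_
    · intro u hu
      rw [interior_Icc] at hu
      exact (hder u (Set.Ioo_subset_Icc_self hu)).differentiableAt.differentiableWithinAt
    · intro u hu
      rw [interior_Icc] at hu
      have hu' := Set.Ioo_subset_Icc_self hu
      rw [(hder u hu').deriv, ← inner_sub_left]
      have h1 := hl _ (hmem u hu') x hx
      have h2 : dist (x + u • d) x = u * ‖d‖ := by
        rw [dist_eq_norm, add_sub_cancel_left, norm_smul, Real.norm_of_nonneg hu'.1]
      have h3 := real_inner_le_norm (∇ g (x + u • d) - ∇ g x) d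
      rw [h2] at h1
      nlinarith [mul_le_mul_of_nonneg_right h1 (norm_nonneg d)]
  have := hanti (Set.left_mem_Icc.2 zero_le_one) (Set.right_mem_Icc.2 zero_le_one) zero_le_one
  simp only [h, zero_smul, one_smul, add_zero, zero_mul, sub_zero] at this
  have hxy : x + d = y := by simp [hdd]
  rw [hxy] at this
  linarith

/-- Combine the descent lemma at the new point, the tangent inequality at `x` and the obtuse angle
at the projection. With smoothness constant `η⁻¹` the quadratic error is exactly the term `‖p - x‖ ^
2` in the expansion of `‖x - z‖ ^ 2`. -/
theorem projected_gradient_step {η : ℝ} (hη : 0 < η) (hC : IsCompact C) (hg : ConvexOn ℝ C g)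
    (hd : ∀ x ∈ C, DifferentiableAt ℝ g x)
    (hl : ∀ x ∈ C, ∀ y ∈ C, ‖∇ g x - ∇ g y‖ ≤ η⁻¹ * dist x y) {x z : E} (hx : x ∈ C)
    (hz : z ∈ C) :
    2 * η * (g (projPoint C (x - η • ∇ g x)) - g z) ≤
      ‖x - z‖ ^ 2 - ‖projPoint C (x - η • ∇ g x) - z‖ ^ 2 := by
  have hp := inner_sub_projPoint_nonpos hC hg.1 (x - η • ∇ g x) hz
  have hmem := (projPoint_spec hC ⟨z, hz⟩ (x - η • ∇ g x)).1
  set p := projPoint C (x - η • ∇ g x)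
  have h1 := le_add_inner_gradient hg.1 hd hl hx hmem
  have h2 := add_inner_gradient_le hg hx hz (hd x hx)
  have h3 : 2 * η * (g p - g z) ≤ 2 * η * inner ℝ (∇ g x) (p - z) + ‖p - x‖ ^ 2 := by
    have h4 : g p - g z ≤ inner ℝ (∇ g x) (p - z) + η⁻¹ / 2 * ‖p - x‖ ^ 2 := by
      have : inner ℝ (∇ g x) (p - z) = inner ℝ (∇ g x) (p - x) - inner ℝ (∇ g x) (z - x) := by
        rw [← inner_sub_right]
        congr 1
        abel
      linarith
    calc 2 * η * (g p - g z)
        ≤ 2 * η * (inner ℝ (∇ g x) (p - z) + η⁻¹ / 2 * ‖p - x‖ ^ 2) := by gcongr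
      _ = _ := by field_simp
  have h5 : x - z = (x - p) + (p - z) := by abel
  have h6 : inner ℝ (x - η • ∇ g x - p) (z - p) =
      η * inner ℝ (∇ g x) (p - z) - inner ℝ (x - p) (p - z) := by
    rw [show z - p = -(p - z) by abel, inner_neg_right,
      show x - η • ∇ g x - p = (x - p) - η • ∇ g x by abel, inner_sub_left,
      real_inner_smul_left]
    ring
  rw [h6] at hp
  rw [h5, norm_add_sq_real, norm_sub_rev x p]
  linarith

theorem projected_gradient_iterate {η : ℝ} (hη : 0 < η) (hC : IsCompact C) (hg : ConvexOn ℝ C g)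
    (hd : ∀ x ∈ C, DifferentiableAt ℝ g x)
    (hl : ∀ x ∈ C, ∀ y ∈ C, ‖∇ g x - ∇ g y‖ ≤ η⁻¹ * dist x y) {x z : E} (hx : x ∈ C)
    (hz : z ∈ C) (k : ℕ) :
    (fun y => projPoint C (y - η • ∇ g y))^[k] x ∈ C ∧
    2 * η * k * (g ((fun y => projPoint C (y - η • ∇ g y))^[k] x) - g z) ≤
      ‖x - z‖ ^ 2 - ‖(fun y => projPoint C (y - η • ∇ g y))^[k] x - z‖ ^ 2 := by
  induction k with
  | zero => simpa using hx
  | succ k ih =>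
    rw [Function.iterate_succ_apply']
    set y := (fun y => projPoint C (y - η • ∇ g y))^[k] x
    obtain ⟨hy, ih⟩ := ih
    refine ⟨(projPoint_spec hC ⟨x, hx⟩ _).1, ?_⟩
    have h1 := projected_gradient_step hη hC hg hd hl hy hz
    -- Comparing with `z = y` shows that the values decrease, so the telescoped sum controls the
    -- last iterate and not just an average.
    have h2 := projected_gradient_step hη hC hg hd hl hy hy
    set p := projPoint C (y - η • ∇ g y)
    have h3 : 2 * η * (g p - g y) ≤ 0 := by
      have := sq_nonneg ‖p - y‖
      simp only [sub_self, norm_zero] at h2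
      linarith
    have h4 := mul_nonpos_of_nonneg_of_nonpos (Nat.cast_nonneg (α := ℝ) k) h3
    push_cast
    nlinarith

end Descent

end FVI

namespace FVI

/-! ### Norms, projections and projected value iteration -/

namespace Problem

variable {S A : Type*} [Fintype S] {K N : ℕ} {P : Problem S A K N} {γ M : ℝ}

omit [Fintype S] in
theorem value_sinf (θ : EuclideanSpace ℝ (Fin N)) : P.value θ P.mdp.sinf = 0 := by
  simp [value]

theorem snorm_sq (hσ : ∀ s, 0 ≤ P.sigma s) (V : S → ℝ) :
    P.snorm V ^ 2 = ∑ s, P.sigma s * V s ^ 2 :=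
  Real.sq_sqrt (Finset.sum_nonneg fun s _ => mul_nonneg (hσ s) (sq_nonneg _))

namespace Standing

variable (hP : P.Standing γ M)
include hP

theorem weight_pos (s : S) : 0 < P.weight s := by
  refine hP.tau_pos _ ?_
  by_cases h : s = P.mdp.sinf
  · rw [h, P.mdp.level_sinf]
  · exact (P.mdp.level_le s h).trans (Nat.le_succ _)

theorem abs_le_tnorm (V : S → ℝ) (s : S) : |V s| ≤ P.tnorm V * P.weight s := by
  rw [← div_le_iff₀ (hP.weight_pos s)]
  exact le_ciSup (f := fun s => |V s| / P.weight s) (Set.finite_range _).bddAbove s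

theorem tnorm_le {V : S → ℝ} {b : ℝ} (h : ∀ s, |V s| ≤ b * P.weight s) : P.tnorm V ≤ b := by
  have : Nonempty S := ⟨P.mdp.sinf⟩
  exact ciSup_le fun s => (div_le_iff₀ (hP.weight_pos s)).2 (h s)

theorem tnorm_nonneg (V : S → ℝ) : 0 ≤ P.tnorm V :=
  Real.iSup_nonneg fun s => div_nonneg (abs_nonneg _) (hP.weight_pos s).le

theorem tnorm_sub_le (U V W : S → ℝ) : P.tnorm (U - W) ≤ P.tnorm (U - V) + P.tnorm (V - W) := by
  refine hP.tnorm_le fun s => ?_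
  have h1 := hP.abs_le_tnorm (U - V) s
  have h2 := hP.abs_le_tnorm (V - W) s
  simp only [Pi.sub_apply] at *
  linarith [abs_sub_le (U s) (V s) (W s)]

theorem sigma_nonneg (s : S) : 0 ≤ P.sigma s := hP.sigma_mem.1 s

theorem nonempty_supp : Nonempty {s // 0 < P.sigma s} := by
  by_contra h
  rw [not_nonempty_iff, isEmpty_subtype] at h
  have h1 : ∑ s, P.sigma s ≤ 0 := Finset.sum_nonpos fun s _ => not_lt.1 (h s)
  linarith [hP.sigma_mem.2]

theorem cSigmaTau_pos : 0 < P.cSigmaTau := by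
  have := hP.nonempty_supp
  obtain ⟨s, hs⟩ := exists_eq_ciInf_of_finite
    (f := fun s : {s // 0 < P.sigma s} => P.weight s.1 * √(P.sigma s.1))
  rw [cSigmaTau, ← hs]
  exact mul_pos (hP.weight_pos _) (Real.sqrt_pos.2 s.2)

/-- One summand is at most the whole sum. The only state without mass is the absorbing one, where
`V` vanishes. -/
theorem tnorm_le_snorm {V : S → ℝ} (hV : V P.mdp.sinf = 0) :
    P.tnorm V ≤ P.snorm V / P.cSigmaTau := by
  have hc := hP.cSigmaTau_pos
  have hn : 0 ≤ P.snorm V := Real.sqrt_nonneg _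
  refine hP.tnorm_le fun s => ?_
  have hw := hP.weight_pos s
  by_cases hs : s = P.mdp.sinf
  · rw [hs, hV, abs_zero]
    rw [hs] at hw
    positivity
  have hσ := (hP.sigma_supp s).2 hs
  have h1 : P.cSigmaTau ≤ P.weight s * √(P.sigma s) :=
    ciInf_le (f := fun s : {s // 0 < P.sigma s} => P.weight s.1 * √(P.sigma s.1))
      (Set.finite_range _).bddBelow ⟨s, hσ⟩
  have h2 : √(P.sigma s) * |V s| ≤ P.snorm V := by
    rw [← Real.sqrt_sq_eq_abs, ← Real.sqrt_mul hσ.le]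
    exact Real.sqrt_le_sqrt (Finset.single_le_sum
      (f := fun s => P.sigma s * V s ^ 2)
      (fun s _ => mul_nonneg (hP.sigma_nonneg s) (sq_nonneg _)) (Finset.mem_univ s))
  rw [div_mul_eq_mul_div, le_div_iff₀ hc]
  calc |V s| * P.cSigmaTau ≤ |V s| * (P.weight s * √(P.sigma s)) := by gcongr
    _ = (√(P.sigma s) * |V s|) * P.weight s := by ring
    _ ≤ _ := by gcongr

theorem continuousOn_value : ContinuousOn P.value P.Theta := by
  refine continuousOn_pi.2 fun s => ?_
  by_cases hs : s = P.mdp.sinf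
  · simp only [hs, value_sinf]
    exact continuousOn_const
  · simp only [value, if_neg hs]
    exact hP.v_continuous.comp (f := fun θ => (P.phi s, θ))
      (by fun_prop) fun θ hθ => ⟨trivial, hθ⟩

theorem exists_proj_eq (V : S → ℝ) : ∃ θ ∈ P.Theta, P.proj V = P.value θ ∧
    ∀ θ' ∈ P.Theta, P.snorm (P.value θ - V) ≤ P.snorm (P.value θ' - V) := by
  have hc : Continuous P.snorm := by
    unfold snorm
    fun_prop
  have h : ∃ θ ∈ P.Theta, ∀ θ' ∈ P.Theta,
      P.snorm (P.value θ - V) ≤ P.snorm (P.value θ' - V) :=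
    hP.theta_compact.exists_isMinOn hP.theta_nonempty
      (hc.comp_continuousOn (hP.continuousOn_value.sub continuousOn_const))
  refine ⟨h.choose, h.choose_spec.1, ?_, h.choose_spec.2⟩
  rw [proj, dif_pos h]

/-- Pythagorean inequality for a projection onto a convex set: minimality along the segment towards
`U` makes the cross term `b` nonnegative. Sums are expanded by hand because `snorm` ignores the
absorbing state and is only a seminorm. -/
theorem snorm_sub_proj_sq_add_le (V : S → ℝ) {U : S → ℝ} (hU : U ∈ P.values) :
    P.snorm (U - P.proj V) ^ 2 + P.snorm (P.proj V - V) ^ 2 ≤ P.snorm (U - V) ^ 2 := by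
  obtain ⟨θ, hθ, heq, hmin⟩ := hP.exists_proj_eq V
  rw [← heq] at hmin
  set p := P.proj V
  have hp : p ∈ P.values := ⟨θ, hθ, heq.symm⟩
  set a := ∑ s, P.sigma s * (U s - p s) ^ 2 with ha
  set b := ∑ s, P.sigma s * ((U s - p s) * (p s - V s)) with hb
  have ha0 : 0 ≤ a := Finset.sum_nonneg fun s _ => mul_nonneg (hP.sigma_nonneg s) (sq_nonneg _)
  have expand : ∀ u : ℝ, P.snorm (p + u • (U - p) - V) ^ 2 =
      P.snorm (p - V) ^ 2 + 2 * u * b + u ^ 2 * a := by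
    intro u
    rw [snorm_sq hP.sigma_nonneg, snorm_sq hP.sigma_nonneg, ha, hb, Finset.mul_sum,
      Finset.mul_sum, ← Finset.sum_add_distrib, ← Finset.sum_add_distrib]
    refine Finset.sum_congr rfl fun s _ => ?_
    simp only [Pi.sub_apply, Pi.add_apply, Pi.smul_apply, smul_eq_mul]
    ring
  have hb0 : 0 ≤ b := by
    by_contra! hneg
    have key : ∀ u ∈ Set.Icc (0 : ℝ) 1, 0 ≤ 2 * u * b + u ^ 2 * a := by
      intro u hu
      obtain ⟨θ', hθ', h'⟩ := hP.values_convex.add_smul_sub_mem hp hU hu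
      have h1 := hmin θ' hθ'
      rw [h'] at h1
      have h2 : P.snorm (p - V) ^ 2 ≤ P.snorm (p + u • (U - p) - V) ^ 2 :=
        pow_le_pow_left₀ (Real.sqrt_nonneg _) h1 2
      rw [expand u] at h2
      linarith
    have hab : 0 < a - b := by linarith
    -- This point of `[0, 1]` makes the quadratic negative when `b < 0`, and it also covers `a = 0`.
    have h1 := key (-b / (a - b)) ⟨by apply div_nonneg <;> linarith, by
      rw [div_le_one hab]; linarith⟩
    have h2 : 2 * (-b / (a - b)) * b + (-b / (a - b)) ^ 2 * a =
        b ^ 2 * (2 * b - a) / (a - b) ^ 2 := by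
      field_simp
      ring
    rw [h2] at h1
    have h3 : b ^ 2 * (2 * b - a) / (a - b) ^ 2 < 0 :=
      div_neg_of_neg_of_pos (mul_neg_of_pos_of_neg (sq_pos_of_neg hneg) (by linarith))
        (pow_pos hab 2)
    linarith
  have h1 := expand 1
  have h2 : P.snorm (U - p) ^ 2 = a := by
    rw [snorm_sq hP.sigma_nonneg]
    rfl
  rw [one_smul, add_sub_cancel] at h1
  rw [h1, h2]
  linarith

theorem projBellman_mem (V : S → ℝ) : P.projBellman V ∈ P.values := by
  obtain ⟨θ, hθ, h, -⟩ := hP.exists_proj_eq (P.mdp.bellman V)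
  exact ⟨θ, hθ, h.symm⟩

theorem iterate_projBellman_mem {V : S → ℝ} (hV : V ∈ P.values) (t : ℕ) :
    P.projBellman^[t] V ∈ P.values := by
  induction t with
  | zero => exact hV
  | succ t _ =>
    rw [Function.iterate_succ_apply']
    exact hP.projBellman_mem _

omit [Fintype S] hP in
theorem _root_.FVI.Problem.apply_sinf_of_mem {V : S → ℝ} (hV : V ∈ P.values) :
    V P.mdp.sinf = 0 := by
  obtain ⟨θ, -, rfl⟩ := hV
  exact value_sinf θ

theorem tnorm_iterate_sub_le {U V : S → ℝ} (hU : U ∈ P.values) (hV : V ∈ P.values) (t : ℕ) :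
    P.tnorm (P.projBellman^[t] U - P.projBellman^[t] V) ≤ γ ^ t * P.tnorm (U - V) := by
  induction t with
  | zero => simp
  | succ t ih =>
    rw [Function.iterate_succ_apply', Function.iterate_succ_apply', pow_succ', mul_assoc]
    exact (hP.contraction _ _ (apply_sinf_of_mem (hP.iterate_projBellman_mem hU t))
      (apply_sinf_of_mem (hP.iterate_projBellman_mem hV t))).trans
      (mul_le_mul_of_nonneg_left ih hP.gamma_nonneg)

theorem tendsto_of_tnorm_sub {u : ℕ → S → ℝ} {V : S → ℝ}
    (h : Tendsto (fun t => P.tnorm (u t - V)) atTop (𝓝 0)) : Tendsto u atTop (𝓝 V) := by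
  refine tendsto_pi_nhds.2 fun s => tendsto_iff_dist_tendsto_zero.2 ?_
  refine squeeze_zero (fun _ => dist_nonneg) (fun t => hP.abs_le_tnorm (u t - V) s) ?_
  simpa using h.mul_const (P.weight s)

theorem continuous_tnorm : Continuous P.tnorm := by
  refine continuous_iff_continuousAt.2 fun V => tendsto_iff_dist_tendsto_zero.2 ?_
  have hbound : ∀ U, dist (P.tnorm U) (P.tnorm V) ≤ ∑ s, |U s - V s| / P.weight s := by
    intro U
    have h1 : ∀ U V : S → ℝ, P.tnorm U - P.tnorm V ≤ ∑ s, |U s - V s| / P.weight s := by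
      intro U V
      rw [sub_le_iff_le_add]
      refine hP.tnorm_le fun s => ?_
      have h2 := hP.abs_le_tnorm V s
      have h3 : |U s - V s| / P.weight s ≤ ∑ s, |U s - V s| / P.weight s :=
        Finset.single_le_sum (f := fun s => |U s - V s| / P.weight s)
          (fun s _ => div_nonneg (abs_nonneg _) (hP.weight_pos s).le) (Finset.mem_univ s)
      rw [div_le_iff₀ (hP.weight_pos s)] at h3
      have h4 := abs_sub_abs_le_abs_sub (U s) (V s)
      linarith
    rw [Real.dist_eq, abs_le']
    refine ⟨h1 U V, ?_⟩
    have := h1 V U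
    simp only [abs_sub_comm (V _)] at this
    linarith
  refine squeeze_zero (fun _ => dist_nonneg) hbound ?_
  have hc : Continuous fun U : S → ℝ => ∑ s, |U s - V s| / P.weight s := by fun_prop
  simpa using hc.tendsto V

/-- Banach's fixed point argument in `tnorm`, run pointwise for the Cauchy property. Compactness of
`Theta` keeps the limit in `values`. The fixed point equation is what the error recursion needs. -/
theorem exists_isPVILimit : ∃ Vt, P.IsPVILimit Vt ∧ P.projBellman Vt = Vt := by
  obtain ⟨θ₀, hθ₀⟩ := hP.theta_nonempty
  set u : ℕ → S → ℝ := fun t => P.projBellman^[t] (P.value θ₀) with hu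
  have hmem₀ : P.value θ₀ ∈ P.values := ⟨θ₀, hθ₀, rfl⟩
  have hmem : ∀ t, u t ∈ P.values := hP.iterate_projBellman_mem hmem₀
  have hstep : ∀ t, P.tnorm (u t - u (t + 1)) ≤ γ ^ t * P.tnorm (u 0 - u 1) := by
    intro t
    have := hP.tnorm_iterate_sub_le hmem₀ (hP.projBellman_mem (P.value θ₀)) t
    rwa [← Function.iterate_succ_apply] at this
  have hcauchy : ∀ s, CauchySeq fun t => u t s := by
    intro s
    refine cauchySeq_of_le_geometric γ (P.tnorm (u 0 - u 1) * P.weight s) hP.gamma_lt_one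
      fun t => ?_
    have h1 := hP.abs_le_tnorm (u t - u (t + 1)) s
    have h2 := mul_le_mul_of_nonneg_right (hstep t) (hP.weight_pos s).le
    rw [Real.dist_eq]
    simp only [Pi.sub_apply] at h1
    linarith
  choose Vt hVt using fun s => cauchySeq_tendsto_of_complete (hcauchy s)
  replace hVt : Tendsto u atTop (𝓝 Vt) := tendsto_pi_nhds.2 hVt
  have hclosed : IsClosed P.values :=
    (hP.theta_compact.image_of_continuousOn hP.continuousOn_value).isClosed
  have hVmem : Vt ∈ P.values := hclosed.mem_of_tendsto hVt (Eventually.of_forall hmem)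
  have hfix : P.projBellman Vt = Vt := by
    have h1 : Tendsto (fun t => P.tnorm (u t - Vt)) atTop (𝓝 0) := by
      have := (hP.continuous_tnorm.tendsto (Vt - Vt)).comp (hVt.sub_const Vt)
      have h0 : P.tnorm 0 = 0 := by simp [tnorm]
      rwa [sub_self, h0] at this
    have h2 : Tendsto (fun t => u (t + 1)) atTop (𝓝 (P.projBellman Vt)) := by
      refine hP.tendsto_of_tnorm_sub ?_
      refine squeeze_zero (fun _ => hP.tnorm_nonneg _) (fun t => ?_)
        (by simpa using h1.const_mul γ)
      simp only [hu, Function.iterate_succ_apply']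
      exact hP.contraction _ _ (apply_sinf_of_mem (hmem t)) (apply_sinf_of_mem hVmem)
    exact tendsto_nhds_unique h2 (hVt.comp (tendsto_add_atTop_nat 1))
  refine ⟨Vt, ⟨hVmem, fun θ hθ => hP.tendsto_of_tnorm_sub ?_⟩, hfix⟩
  refine squeeze_zero (fun _ => hP.tnorm_nonneg _)
    (g := fun t => γ ^ t * P.tnorm (P.value θ - Vt)) (fun t => ?_) ?_
  · have := hP.tnorm_iterate_sub_le ⟨θ, hθ, rfl⟩ hVmem t
    rwa [Function.iterate_fixed hfix] at this
  · simpa using (tendsto_pow_atTop_nhds_zero_of_lt_one hP.gamma_nonneg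
      hP.gamma_lt_one).mul_const (P.tnorm (P.value θ - Vt))

end Standing

end Problem

end FVI

namespace FVI

/-! ### The error of one iteration -/

/-- The empirical frequency of `s` among `x 0, …, x (n - 1)`. -/
noncomputable def freq {S : Type*} (n : ℕ) (x : ℕ → S) (s : S) : ℝ :=
  open Classical in (1 / (n : ℝ)) * ∑ i ∈ Finset.range n, if x i = s then 1 else 0

namespace Problem

variable {S A : Type*} [Fintype S] {K N : ℕ} {P : Problem S A K N} {γ M : ℝ}

/-- Grouping samples by state puts the empirical loss in the form of the true one, with `freq` in
place of `sigma`. -/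
theorem empLoss_eq_sum_freq (θ₀ : EuclideanSpace ℝ (Fin N)) (n : ℕ) (x : ℕ → S)
    (θ : EuclideanSpace ℝ (Fin N)) :
    P.empLoss θ₀ n x θ = ∑ s, freq n x s * P.sampleLoss θ₀ θ s := by
  classical
  simp only [empLoss, freq, mul_assoc, ← Finset.mul_sum, Finset.sum_mul]
  rw [Finset.sum_comm]
  simp

theorem snorm_value_sub_bellman_sq (hσ : ∀ s, 0 ≤ P.sigma s) (θ₀ θ : EuclideanSpace ℝ (Fin N)) :
    P.snorm (P.value θ - P.mdp.bellman (P.value θ₀)) ^ 2 =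
      ∑ s, P.sigma s * P.sampleLoss θ₀ θ s := by
  rw [snorm_sq hσ]
  refine Finset.sum_congr rfl fun s _ => ?_
  rw [sampleLoss, Pi.sub_apply, sub_sq_comm]

namespace Standing

variable (hP : P.Standing γ M)
include hP

theorem exists_bellman_sub_le [Fintype A] [Nonempty A] : ∃ b : ℝ, 0 ≤ b ∧ ∀ θ₀ ∈ P.Theta,
    ∀ θ ∈ P.Theta, ∀ s, |P.mdp.bellman (P.value θ₀) s - P.value θ s| ≤ b := by
  obtain ⟨b, hb⟩ := hP.theta_compact.exists_bound_of_continuousOn hP.continuousOn_value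
  have hval : ∀ θ ∈ P.Theta, ∀ s, |P.value θ s| ≤ b := fun θ hθ s =>
    (norm_le_pi_norm (P.value θ) s).trans (hb θ hθ)
  obtain ⟨θ₁, hθ₁⟩ := hP.theta_nonempty
  have hb0 : 0 ≤ b := (abs_nonneg _).trans (hval θ₁ hθ₁ P.mdp.sinf)
  set r := ∑ p : S × A, |P.mdp.reward p.1 p.2|
  have hr0 : 0 ≤ r := Finset.sum_nonneg fun _ _ => abs_nonneg _
  refine ⟨r + b + b, by positivity, fun θ₀ hθ₀ θ hθ s => ?_⟩
  have hq : ∀ a, |P.mdp.reward s a + P.value θ₀ (P.mdp.next s a)| ≤ r + b := fun a =>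
    (abs_add_le _ _).trans (add_le_add (Finset.single_le_sum
      (f := fun p : S × A => |P.mdp.reward p.1 p.2|) (fun _ _ => abs_nonneg _)
      (Finset.mem_univ (s, a))) (hval θ₀ hθ₀ _))
  have hB : |P.mdp.bellman (P.value θ₀) s| ≤ r + b := by
    rw [abs_le]
    obtain ⟨a⟩ := ‹Nonempty A›
    exact ⟨le_ciSup_of_le (Set.finite_range _).bddAbove a (abs_le.1 (hq a)).1,
      ciSup_le fun a => (abs_le.1 (hq a)).2⟩
  exact (abs_sub _ _).trans (add_le_add hB (hval θ hθ s))

omit hP in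
theorem _root_.FVI.Problem.lip_le_lipSup (s : S) : P.lip s ≤ P.lipSup :=
  le_ciSup (Set.finite_range _).bddAbove s

theorem lipSup_nonneg : 0 ≤ P.lipSup :=
  Real.iSup_nonneg hP.lip_nonneg

theorem dist_le_diam {θ θ' : EuclideanSpace ℝ (Fin N)} (hθ : θ ∈ P.Theta) (hθ' : θ' ∈ P.Theta) :
    dist θ θ' ≤ P.diam :=
  Metric.dist_le_diam_of_mem hP.theta_compact.isBounded hθ hθ'

/-- A difference of squares. The factor `lipSup * diam` is kept visible because the sample bound
gives no control over `n` when it vanishes. -/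
theorem exists_sampleLoss_sub_le [Fintype A] [Nonempty A] : ∃ b : ℝ, 0 ≤ b ∧ ∀ θ₀ ∈ P.Theta,
    ∀ θ ∈ P.Theta, ∀ θ' ∈ P.Theta, ∀ s,
      |P.sampleLoss θ₀ θ s - P.sampleLoss θ₀ θ' s| ≤ b * (P.lipSup * P.diam) := by
  obtain ⟨b, hb0, hb⟩ := hP.exists_bellman_sub_le
  refine ⟨b + b, by positivity, fun θ₀ hθ₀ θ hθ θ' hθ' s => ?_⟩
  have h1 : P.sampleLoss θ₀ θ s - P.sampleLoss θ₀ θ' s =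
      ((P.mdp.bellman (P.value θ₀) s - P.value θ s) +
        (P.mdp.bellman (P.value θ₀) s - P.value θ' s)) * (P.value θ' s - P.value θ s) := by
    rw [sampleLoss, sampleLoss]
    ring
  rw [h1, abs_mul]
  have h2 := (abs_add_le _ _).trans (add_le_add (hb θ₀ hθ₀ θ hθ s) (hb θ₀ hθ₀ θ' hθ' s))
  have h3 : |P.value θ' s - P.value θ s| ≤ P.lipSup * P.diam :=
    (hP.value_lip s θ' hθ' θ hθ).trans (mul_le_mul (lip_le_lipSup s)
      (hP.dist_le_diam hθ' hθ) dist_nonneg hP.lipSup_nonneg)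
  exact mul_le_mul h2 h3 (abs_nonneg _) (by positivity)

section Empirical

variable {θ₀ : EuclideanSpace ℝ (Fin N)} (hθ₀ : θ₀ ∈ P.Theta) {n : ℕ} (x : ℕ → S)
include hθ₀

theorem convexOn_empLoss (n : ℕ) : ConvexOn ℝ P.Theta (P.empLoss θ₀ n x) := by
  have hsum : ∀ k : ℕ, ConvexOn ℝ P.Theta
      (fun θ => ∑ i ∈ Finset.range k, P.sampleLoss θ₀ θ (x i)) := by
    intro k
    induction k with
    | zero => simpa using convexOn_const (0 : ℝ) hP.theta_convex
    | succ k ih =>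
      simp only [Finset.sum_range_succ]
      exact ih.add (hP.loss_convex θ₀ hθ₀ (x k))
  exact (hsum n).smul (by positivity : (0 : ℝ) ≤ 1 / n)

theorem hasGradientAt_empLoss (n : ℕ) {θ : EuclideanSpace ℝ (Fin N)} (hθ : θ ∈ P.Theta) :
    HasGradientAt (P.empLoss θ₀ n x)
      ((1 / (n : ℝ)) • ∑ i ∈ Finset.range n, ∇ (fun θ => P.sampleLoss θ₀ θ (x i)) θ) θ := by
  rw [hasGradientAt_iff_hasFDerivAt, map_smul, map_sum]
  refine HasFDerivAt.const_mul (HasFDerivAt.fun_sum fun i _ => ?_) _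
  exact (hP.loss_differentiable θ₀ hθ₀ (x i) θ hθ).hasGradientAt

theorem norm_gradient_empLoss_sub_le (hn : 0 < n) {L : ℝ} (hL : M ≤ L)
    {θ θ' : EuclideanSpace ℝ (Fin N)} (hθ : θ ∈ P.Theta) (hθ' : θ' ∈ P.Theta) :
    ‖∇ (P.empLoss θ₀ n x) θ - ∇ (P.empLoss θ₀ n x) θ'‖ ≤ L * dist θ θ' := by
  rw [(hP.hasGradientAt_empLoss hθ₀ x n hθ).gradient,
    (hP.hasGradientAt_empLoss hθ₀ x n hθ').gradient, ← smul_sub, ← Finset.sum_sub_distrib,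
    norm_smul, Real.norm_of_nonneg (by positivity)]
  have hn' : (0 : ℝ) < n := Nat.cast_pos.2 hn
  rw [one_div_mul_eq_div, div_le_iff₀ hn']
  refine (norm_sum_le _ _).trans ((Finset.sum_le_sum (g := fun _ => L * dist θ θ')
    fun i _ => ?_).trans ?_)
  · exact (hP.loss_gradient_lip θ₀ hθ₀ (x i) θ hθ θ' hθ').trans
      (mul_le_mul_of_nonneg_right hL dist_nonneg)
  · simp [mul_comm]

theorem empLoss_iterate_pgdStep {η : ℝ} (hη : 0 < η) (hηM : η * M ≤ 1) (hn : 0 < n) {e : ℝ}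
    (he : 0 < e) {c : ℕ} (hc : P.stepBound η e ≤ c) {z : EuclideanSpace ℝ (Fin N)}
    (hz : z ∈ P.Theta) :
    (P.pgdStep η θ₀ n x)^[c] θ₀ ∈ P.Theta ∧
      P.empLoss θ₀ n x ((P.pgdStep η θ₀ n x)^[c] θ₀) - P.empLoss θ₀ n x z ≤ e / 2 := by
  have hM : M ≤ η⁻¹ := by
    rwa [← one_div, le_div_iff₀' hη]
  obtain ⟨hmem, hle⟩ := projected_gradient_iterate hη hP.theta_compact
    (hP.convexOn_empLoss hθ₀ x n)
    (fun θ hθ => (hP.hasGradientAt_empLoss hθ₀ x n hθ).differentiableAt)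
    (fun θ hθ θ' hθ' => hP.norm_gradient_empLoss_sub_le hθ₀ x hn hM hθ hθ') hθ₀ hz c
  refine ⟨hmem, ?_⟩
  change 2 * η * c * (P.empLoss θ₀ n x ((P.pgdStep η θ₀ n x)^[c] θ₀) - P.empLoss θ₀ n x z) ≤ _
    at hle
  have hdist := hP.dist_le_diam hθ₀ hz
  have hD : P.diam ^ 2 ≤ c * (η * e) := (div_le_iff₀ (by positivity)).1 hc
  have hD2 : ‖θ₀ - z‖ ^ 2 ≤ P.diam ^ 2 := by
    rw [← dist_eq_norm]
    exact pow_le_pow_left₀ dist_nonneg hdist 2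
  -- Zero steps satisfy the bound only when the diameter is zero, and then `θ₀ = z`.
  rcases Nat.eq_zero_or_pos c with rfl | hcpos
  · have h0 : ‖θ₀ - z‖ ^ 2 ≤ 0 := by simpa using hD2.trans hD
    have h1 : θ₀ = z := by
      rw [← sub_eq_zero, ← norm_eq_zero]
      exact pow_eq_zero_iff two_ne_zero |>.1 (le_antisymm h0 (sq_nonneg _))
    simp only [Function.iterate_zero, id, h1, sub_self]
    positivity
  · have hc' : (0 : ℝ) < c := Nat.cast_pos.2 hcpos
    have hpos : 0 < 2 * η * c := by positivity
    refine le_of_mul_le_mul_left ?_ hpos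
    calc _ ≤ ‖θ₀ - z‖ ^ 2 := hle.trans (sub_le_self _ (sq_nonneg _))
      _ ≤ c * (η * e) := hD2.trans hD
      _ = 2 * η * c * (e / 2) := by ring

/-- The Pythagorean inequality bounds the squared distance to the projection by the excess true
loss. Passing to the excess empirical loss costs the frequency deviation, and the optimisation gap
is at most `e / 2`. -/
theorem snorm_iterate_pgdStep_sub_sq_le {b : ℝ} (hb : ∀ θ ∈ P.Theta, ∀ θ' ∈ P.Theta, ∀ s,
      |P.sampleLoss θ₀ θ s - P.sampleLoss θ₀ θ' s| ≤ b)
    {η : ℝ} (hη : 0 < η) (hηM : η * M ≤ 1) (hn : 0 < n) {e : ℝ}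
    (he : 0 < e) {c : ℕ} (hc : P.stepBound η e ≤ c) :
    P.snorm (P.value ((P.pgdStep η θ₀ n x)^[c] θ₀) - P.projBellman (P.value θ₀)) ^ 2 ≤
      b * ∑ s, |freq n x s - P.sigma s| + e / 2 := by
  obtain ⟨z, hz, hzeq, -⟩ := hP.exists_proj_eq (P.mdp.bellman (P.value θ₀))
  obtain ⟨hmem, hgap⟩ := hP.empLoss_iterate_pgdStep hθ₀ x hη hηM hn he hc hz
  set θ₁ := (P.pgdStep η θ₀ n x)^[c] θ₀
  have h1 := hP.snorm_sub_proj_sq_add_le (P.mdp.bellman (P.value θ₀)) ⟨θ₁, hmem, rfl⟩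
  rw [snorm_value_sub_bellman_sq hP.sigma_nonneg] at h1
  nth_rewrite 2 [hzeq] at h1
  rw [snorm_value_sub_bellman_sq hP.sigma_nonneg] at h1
  rw [projBellman]
  rw [empLoss_eq_sum_freq, empLoss_eq_sum_freq, ← Finset.sum_sub_distrib] at hgap
  have h2 : ∑ s, P.sigma s * P.sampleLoss θ₀ θ₁ s - ∑ s, P.sigma s * P.sampleLoss θ₀ z s ≤
      b * ∑ s, |freq n x s - P.sigma s| +
        ∑ s, (freq n x s * P.sampleLoss θ₀ θ₁ s - freq n x s * P.sampleLoss θ₀ z s) := by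
    rw [← Finset.sum_sub_distrib, Finset.mul_sum, ← Finset.sum_add_distrib]
    refine Finset.sum_le_sum fun s _ => ?_
    have h3 := mul_le_mul_of_nonneg_left (hb θ₁ hmem z hz s) (abs_nonneg (freq n x s - P.sigma s))
    rw [← abs_mul] at h3
    linarith [neg_abs_le ((freq n x s - P.sigma s) *
      (P.sampleLoss θ₀ θ₁ s - P.sampleLoss θ₀ z s))]
  linarith

end Empirical

end Standing

end Problem

end FVI

namespace FVI

/-! ### Samples -/

section Sampling

variable {S Ω : Type*} [Finite S] [MeasurableSpace S] [MeasurableSingletonClass S]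
  [MeasurableSpace Ω] {σ : S → ℝ} {μ : Measure Ω} [IsProbabilityMeasure μ] {X : ℕ → ℕ → Ω → S}

/-- This is the variance of a mean of pairwise independent indicators, each of variance at most `1 /
4`. -/
theorem IsIIDSample.integral_freq_sub_sq_le (hX : IsIIDSample σ μ X) (t : ℕ) {n : ℕ} (hn : 0 < n)
    (s : S) : ∫ w, (freq n (fun i => X t i w) s - σ s) ^ 2 ∂μ ≤ 1 / n := by
  classical
  let φ : S → ℝ := fun y => if y = s then 1 else 0
  let Y : ℕ → Ω → ℝ := fun i w => φ (X t i w)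
  have hφ : Measurable φ := measurable_of_finite φ
  have hY : ∀ i, Measurable (Y i) := fun i => hφ.comp (hX.measurable t i)
  have hY01 : ∀ i w, Y i w ∈ Set.Icc (0 : ℝ) 1 := by
    intro i w
    simp only [Y, φ]
    split_ifs <;> simp
  have hL2 : ∀ i, MemLp (Y i) 2 μ := fun i =>
    memLp_of_bounded (Eventually.of_forall (hY01 i)) (hY i).aestronglyMeasurable 2
  have hmean : ∀ i, ∫ w, Y i w ∂μ = σ s := by
    intro i
    have h1 : Y i = (X t i ⁻¹' {s}).indicator 1 := by
      ext w
      simp [Y, φ, Set.indicator_apply]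
    rw [h1, integral_indicator_one (hX.measurable t i (measurableSet_singleton s)), hX.law]
  have hindep : ∀ i j, i ≠ j → IndepFun (Y i) (Y j) μ := fun i j hij =>
    (hX.indep.indepFun (i := (t, i)) (j := (t, j)) (by simpa using hij)).comp hφ hφ
  have hn' : (0 : ℝ) < n := Nat.cast_pos.2 hn
  have hvar : Var[∑ i ∈ Finset.range n, Y i; μ] ≤ n := by
    rw [IndepFun.variance_sum (fun i _ => hL2 i) (fun i _ j _ hij => hindep i j hij)]
    refine (Finset.sum_le_sum (g := fun _ => (1 : ℝ)) fun i _ => ?_).trans (by simp)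
    refine (variance_le_sq_of_bounded (Eventually.of_forall (hY01 i)) (hY i).aemeasurable).trans ?_
    norm_num
  have hsum : ∫ w, (∑ i ∈ Finset.range n, Y i) w ∂μ = n * σ s := by
    simp only [Finset.sum_apply]
    rw [integral_finsetSum _ fun i _ => (hL2 i).integrable one_le_two]
    simp [hmean]
  have heq : ∀ w, (freq n (fun i => X t i w) s - σ s) ^ 2 =
      (1 / (n : ℝ) ^ 2) * ((∑ i ∈ Finset.range n, Y i) w - n * σ s) ^ 2 := by
    intro w
    have : freq n (fun i => X t i w) s = (1 / (n : ℝ)) * (∑ i ∈ Finset.range n, Y i) w := by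
      simp only [freq, Finset.sum_apply, Y, φ]
    rw [this]
    field_simp
  simp only [heq]
  rw [integral_const_mul]
  have h2 := variance_eq_integral (μ := μ) (X := ∑ i ∈ Finset.range n, Y i)
    (Finset.aemeasurable_sum _ fun i _ => (hY i).aemeasurable)
  rw [hsum] at h2
  rw [← h2, one_div_mul_eq_div, div_le_div_iff₀ (by positivity) hn']
  nlinarith

/-- Such a `G` factors through the finite type `J → S`, where every function is measurable and
bounded. Measurability of the descent map thus needs no study. -/
theorem IsIIDSample.integrable_of_finite_dependence (hX : IsIIDSample σ μ X)
    (J : Finset (ℕ × ℕ)) (G : (ℕ → ℕ → S) → ℝ)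
    (hG : ∀ x y : ℕ → ℕ → S, (∀ p ∈ J, x p.1 p.2 = y p.1 p.2) → G x = G y) :
    Integrable (fun w => G fun t i => X t i w) μ := by
  classical
  obtain ⟨w₀⟩ : Nonempty Ω := μ.nonempty_of_neZero
  -- Coordinates outside `J` receive an arbitrary state.
  let ext : (J → S) → ℕ → ℕ → S := fun z t i => if h : (t, i) ∈ J then z ⟨(t, i), h⟩ else X 0 0 w₀
  let Z : Ω → J → S := fun w p => X p.1.1 p.1.2 w
  have hZ : Measurable Z := measurable_pi_lambda _ fun p => hX.measurable _ _
  have heq : (fun w => G fun t i => X t i w) = fun w => G (ext (Z w)) := by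
    funext w
    refine hG _ _ fun p hp => ?_
    simp [ext, Z, hp]
  rw [heq]
  have hm : Measurable fun z => G (ext z) := measurable_of_finite _
  obtain ⟨b, hb⟩ := (Set.finite_range fun z => ‖G (ext z)‖).bddAbove
  exact Integrable.of_bound (hm.comp hZ).aestronglyMeasurable b
    (Eventually.of_forall fun w => hb ⟨Z w, rfl⟩)

end Sampling

namespace Problem

variable {S A : Type*} {K N : ℕ} {P : Problem S A K N}

theorem iterate_congr (η : ℝ) (n c : ℕ → ℕ) {x y : ℕ → ℕ → S}
    (θ₀ : EuclideanSpace ℝ (Fin N)) (t : ℕ) (h : ∀ u < t, ∀ i < n u, x u i = y u i) :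
    P.iterate η n c x θ₀ t = P.iterate η n c y θ₀ t := by
  induction t with
  | zero => rfl
  | succ t ih =>
    simp only [iterate]
    rw [ih fun u hu => h u (hu.trans (Nat.lt_succ_self t))]
    have hemp : ∀ θ, P.empLoss θ (n t) (x t) = P.empLoss θ (n t) (y t) := by
      intro θ
      funext θ'
      simp only [empLoss]
      congr 1
      refine Finset.sum_congr rfl fun i hi => ?_
      rw [h t (Nat.lt_succ_self t) i (Finset.mem_range.1 hi)]
    unfold pgdStep
    simp only [hemp]

end Problem

end FVI

namespace FVI

/-! ### The error recursion in expectation -/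

theorem acc_pos {ε₀ δ : ℝ} (hε₀ : 0 < ε₀) (hδ : 0 < δ) (t : ℕ) : 0 < acc ε₀ δ t := by
  unfold acc
  positivity

theorem acc_le {ε₀ δ : ℝ} (hε₀ : 0 < ε₀) (hδ : 0 < δ) (t : ℕ) : acc ε₀ δ t ≤ ε₀ :=
  div_le_self hε₀.le (one_le_pow₀ (by linarith))

theorem sqrt_acc {ε₀ δ : ℝ} (hδ : 0 < δ) (t : ℕ) :
    √(acc ε₀ δ t) = √ε₀ * (1 / √(1 + δ)) ^ t := by
  have h : √((1 + δ) ^ t) = √(1 + δ) ^ t := by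
    rw [Real.sqrt_eq_iff_eq_sq (by positivity) (by positivity), ← pow_mul, mul_comm, pow_mul,
      Real.sq_sqrt (by positivity)]
  rw [acc, Real.sqrt_div' _ (by positivity), h, one_div, inv_pow, div_eq_mul_inv]

theorem gammaStar_pos {γ δ : ℝ} (hδ : 0 < δ) : 0 < gammaStar γ δ :=
  lt_max_of_lt_right (by positivity)

theorem gammaStar_lt_one {γ δ : ℝ} (hγ : γ < 1) (hδ : 0 < δ) : gammaStar γ δ < 1 := by
  refine max_lt hγ ?_
  rw [div_lt_one (by positivity), Real.lt_sqrt zero_le_one]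
  linarith

theorem expo_pos {γ δ : ℝ} (hγ : γ < 1) (hδ : 0 < δ) : 0 < expo γ δ := by
  have := Real.logb_neg (b := 1 + δ) (by linarith) (gammaStar_pos (γ := γ) hδ)
    (gammaStar_lt_one hγ hδ)
  rw [expo, neg_pos]
  exact div_neg_of_pos_of_neg two_pos this

/-- Young's inequality. Applied pathwise it replaces absolute values and square roots by squares, so
that linearity of the integral suffices later. -/
theorem le_sq_div_add {z h : ℝ} (hh : 0 < h) : z ≤ z ^ 2 / (2 * h) + h / 2 := by
  have : z ^ 2 / (2 * h) + h / 2 - z = (z - h) ^ 2 / (2 * h) := by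
    field_simp
    ring
  have : 0 ≤ (z - h) ^ 2 / (2 * h) := by positivity
  linarith

namespace Problem

variable {S A : Type*} [Fintype S] {K N : ℕ} {P : Problem S A K N} {γ M : ℝ}

namespace Standing

variable (hP : P.Standing γ M)
include hP

theorem gammaTau_nonneg : 0 ≤ P.gammaTau :=
  Real.iSup_nonneg fun l => div_nonneg (hP.tau_pos _ (by have := l.2; omega)).le
    (hP.tau_pos _ (by have := l.2; omega)).le

theorem gammaTau_lt_one : P.gammaTau < 1 := by
  obtain ⟨l, hl⟩ := exists_eq_ciSup_of_finite
    (f := fun l : Fin (P.mdp.depth + 1) => P.tau (l + 1) / P.tau l)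
  rw [gammaTau, ← hl, div_lt_one (hP.tau_pos _ (by have := l.2; omega))]
  exact hP.tau_lt _ (by have := l.2; omega)

theorem tau_le_tau_zero : ∀ l ≤ P.mdp.depth + 1, P.tau l ≤ P.tau 0 := by
  intro l hl
  induction l with
  | zero => exact le_rfl
  | succ l ih => exact (hP.tau_lt l (by omega)).le.trans (ih (by omega))

theorem rho_nonneg [Finite A] [Nonempty A] : 0 ≤ P.rho := by
  have hR : 0 ≤ P.mdp.maxReward := by
    obtain ⟨a⟩ := ‹Nonempty A›
    exact le_ciSup_of_le (f := fun p : S × A => P.mdp.reward p.1 p.2)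
      (Set.finite_range _).bddAbove (P.mdp.sinf, a) (P.mdp.reward_sinf a).ge
  have h1 : 0 ≤ 1 - P.gammaTau := by linarith [hP.gammaTau_lt_one]
  have h2 : 0 ≤ 1 / P.tau (P.mdp.depth + 1) - 1 / P.tau 0 :=
    sub_nonneg.2 (one_div_le_one_div_of_le (hP.tau_pos _ le_rfl) (hP.tau_le_tau_zero _ le_rfl))
  have h3 := hP.gammaTau_nonneg
  unfold rho
  positivity

omit [Fintype S] hP in
theorem _root_.FVI.Problem.diam_nonneg : 0 ≤ P.diam := Metric.diam_nonneg

theorem rho'_pos {ε₀ : ℝ} (hε₀ : 0 < ε₀) : 0 < P.rho' γ ε₀ := by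
  have h1 : 0 < 1 - γ := by linarith [hP.gamma_lt_one]
  have h2 := hP.tnorm_nonneg P.lip
  have h3 := hP.cSigmaTau_pos
  have h4 := P.diam_nonneg
  unfold rho'
  positivity

theorem le_zeta : 2 * (P.lipSup * P.diam) ≤ P.zeta γ := by
  have h0 := hP.tau_pos 0 (Nat.zero_le _)
  have h1 := hP.tau_pos P.mdp.depth (Nat.le_succ _)
  have h2 := hP.gammaTau_nonneg
  have h3 : 0 < 1 - γ := by linarith [hP.gamma_lt_one]
  have h4 := hP.gamma_nonneg
  have h5 := hP.tnorm_nonneg (P.mdp.optValue - P.proj P.mdp.optValue)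
  have h6 : 0 ≤ P.lipSup * P.diam := mul_nonneg hP.lipSup_nonneg P.diam_nonneg
  have h7 : 0 ≤ P.tau 0 * P.gammaTau / P.tau P.mdp.depth * (P.lipSup * P.diam) := by positivity
  have h8 : 0 ≤ P.tau 0 * γ * (1 + P.gammaTau) / (1 - γ) *
      P.tnorm (P.mdp.optValue - P.proj P.mdp.optValue) := by positivity
  unfold zeta
  linarith

/-- All that is needed from the sample bound is `n ≳ e⁻²`. If `lipSup * diam = 0`, then `omega`
vanishes and nothing is imposed, hence the prefactor. Otherwise `zeta`, and with it `omega`, is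
positive. -/
theorem exists_lip_div_le {ν δ' : ℝ} (hν : 0 < ν) (hδ' : 0 < δ') :
    ∃ C : ℝ, 0 ≤ C ∧ ∀ e : ℝ, 0 < e → e < 1 / 4 → ∀ n : ℕ, 0 < n →
      P.sampleBound γ ν δ' e ≤ n → P.lipSup * P.diam * (1 / n) ≤ C * e ^ 2 := by
  have hL := hP.lipSup_nonneg
  have hD := P.diam_nonneg
  rcases (mul_nonneg hL hD).eq_or_lt with h0 | hpos
  · refine ⟨0, le_rfl, fun e _ _ n _ _ => ?_⟩
    rw [← h0]
    simp
  have hD' : 0 < P.diam := pos_of_mul_pos_right hpos hL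
  have hL' : 0 < P.lipSup := pos_of_mul_pos_left hpos hD
  have hz : 0 < P.zeta γ := by linarith [hP.le_zeta]
  have hE : 0 ≤ ∑ s, P.sigma s * P.lip s :=
    Finset.sum_nonneg fun s _ => mul_nonneg (hP.sigma_nonneg s) (hP.lip_nonneg s)
  have hω : 0 < P.omega γ := by
    unfold omega
    positivity
  set β := 16 * ν * P.diam * (P.kappaStar γ + δ') with hβdef
  have hκ : 0 < P.kappaStar γ + δ' := by
    unfold kappaStar
    positivity
  have hβ : 0 < β := by positivity
  refine ⟨P.lipSup * P.diam * (1 / (16 * P.omega γ ^ 2) + 1 / β ^ 2), by positivity,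
    fun e he he4 n hn hle => ?_⟩
  have hn1 : (1 : ℝ) ≤ n := by exact_mod_cast hn
  rw [mul_assoc (P.lipSup * P.diam)]
  refine mul_le_mul_of_nonneg_left ?_ hpos.le
  rw [add_mul]
  -- For `e ≤ β` the covering logarithm is nonnegative and `log (1 / e) ≥ log 4 > 1` supplies the
  -- samples. For `e > β` that logarithm may be negative, but then `1 / n ≤ 1 ≤ e ^ 2 / β ^ 2`.
  rcases le_or_gt e β with h | h
  · have h1 : 0 ≤ Real.log (β / e) := Real.log_nonneg ((one_le_div he).2 h)
    have h2 : 1 ≤ Real.log (1 / e) := by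
      have h4 : Real.log 4 ≤ Real.log (1 / e) := by
        refine Real.log_le_log (by norm_num) ?_
        rw [le_div_iff₀ he]
        linarith
      have h5 : Real.log 4 = 2 * Real.log 2 := by
        rw [show (4 : ℝ) = 2 ^ 2 by norm_num, Real.log_pow]
        norm_num
      linarith [Real.log_two_gt_d9]
    have h3 : 16 * P.omega γ ^ 2 / e ^ 2 ≤ n := by
      refine le_trans ?_ ((le_max_left _ _).trans hle)
      rw [← hβdef]
      calc 16 * P.omega γ ^ 2 / e ^ 2 = 32 * P.omega γ ^ 2 / e ^ 2 * (1 / 2) := by ring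
        _ ≤ _ := by
          refine mul_le_mul_of_nonneg_left ?_ (by positivity)
          have : 0 ≤ (N : ℝ) * Real.log (β / e) := by positivity
          linarith
    have h4 : 1 / (n : ℝ) ≤ 1 / (16 * P.omega γ ^ 2 / e ^ 2) :=
      one_div_le_one_div_of_le (by positivity) h3
    have h5 : 1 / (16 * P.omega γ ^ 2 / e ^ 2) = 1 / (16 * P.omega γ ^ 2) * e ^ 2 := by
      field_simp
    have h6 : 0 ≤ 1 / β ^ 2 * e ^ 2 := by positivity
    linarith
  · have h1 : 1 ≤ 1 / β ^ 2 * e ^ 2 := by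
      rw [one_div_mul_eq_div, one_le_div (by positivity)]
      exact pow_le_pow_left₀ hβ.le h.le 2
    have h2 : 1 / (n : ℝ) ≤ 1 := (div_le_one (by linarith)).2 hn1
    have h3 : 0 ≤ 1 / (16 * P.omega γ ^ 2) * e ^ 2 := by positivity
    linarith

/-- Contraction towards the fixed point plus the one-step error. Young's inequality is used with
parameter `e` for the frequencies and `√e` for the norm, the expected orders of these quantities. -/
theorem tnorm_iterate_pgdStep_sub_le {Vt : S → ℝ} (hVt : Vt ∈ P.values)
    (hfix : P.projBellman Vt = Vt) {θ₀ : EuclideanSpace ℝ (Fin N)} (hθ₀ : θ₀ ∈ P.Theta)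
    {n : ℕ} (x : ℕ → S) {b : ℝ} (hb0 : 0 ≤ b)
    (hb : ∀ θ ∈ P.Theta, ∀ θ' ∈ P.Theta, ∀ s,
      |P.sampleLoss θ₀ θ s - P.sampleLoss θ₀ θ' s| ≤ b)
    {η : ℝ} (hη : 0 < η) (hηM : η * M ≤ 1) (hn : 0 < n) {e : ℝ}
    (he : 0 < e) {c : ℕ} (hc : P.stepBound η e ≤ c) :
    P.tnorm (P.value ((P.pgdStep η θ₀ n x)^[c] θ₀) - Vt) ≤ γ * P.tnorm (P.value θ₀ - Vt) +
      ((b * ∑ s, ((freq n x s - P.sigma s) ^ 2 / (2 * e) + e / 2) + e / 2) / (2 * √e) + √e / 2) /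
        P.cSigmaTau := by
  have hsq := hP.snorm_iterate_pgdStep_sub_sq_le hθ₀ x hb hη hηM hn he hc
  set θ₁ := (P.pgdStep η θ₀ n x)^[c] θ₀
  have he' : 0 < √e := Real.sqrt_pos.2 he
  have hcpos := hP.cSigmaTau_pos
  have h1 := hP.tnorm_sub_le (P.value θ₁) (P.projBellman (P.value θ₀)) Vt
  have h2 := hP.contraction (P.value θ₀) Vt (value_sinf θ₀) (apply_sinf_of_mem hVt)
  rw [hfix] at h2
  have h3 := hP.tnorm_le_snorm (V := P.value θ₁ - P.projBellman (P.value θ₀)) (by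
    rw [Pi.sub_apply, value_sinf, apply_sinf_of_mem (hP.projBellman_mem _), sub_zero])
  have h4 : ∑ s, |freq n x s - P.sigma s| ≤
      ∑ s, ((freq n x s - P.sigma s) ^ 2 / (2 * e) + e / 2) :=
    Finset.sum_le_sum fun s _ => by
      simpa using le_sq_div_add (z := |freq n x s - P.sigma s|) he
  have h5 : P.snorm (P.value θ₁ - P.projBellman (P.value θ₀)) ≤
      (b * ∑ s, ((freq n x s - P.sigma s) ^ 2 / (2 * e) + e / 2) + e / 2) / (2 * √e) + √e / 2 := by
    refine (le_sq_div_add he').trans ?_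
    gcongr
    exact hsq.trans (by gcongr)
  have h6 := div_le_div_of_nonneg_right h5 hcpos.le
  linarith

theorem iterate_mem {η : ℝ} (n c : ℕ → ℕ) (x : ℕ → ℕ → S) {θ₀ : EuclideanSpace ℝ (Fin N)}
    (hθ₀ : θ₀ ∈ P.Theta) (t : ℕ) : P.iterate η n c x θ₀ t ∈ P.Theta := by
  induction t with
  | zero => exact hθ₀
  | succ t ih =>
    have h : Set.MapsTo (P.pgdStep η (P.iterate η n c x θ₀ t) (n t) (x t)) P.Theta P.Theta :=
      fun θ _ => (projPoint_spec hP.theta_compact hP.theta_nonempty _).1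
    exact h.iterate (c t) ih

variable [MeasurableSpace S] [MeasurableSingletonClass S]

omit hP in
theorem _root_.FVI.IsIIDSample.integrable_tnorm_iterate {Ω : Type*} [MeasurableSpace Ω]
    {μ : Measure Ω} [IsProbabilityMeasure μ] {X : ℕ → ℕ → Ω → S} (hX : IsIIDSample P.sigma μ X)
    (η : ℝ) (n c : ℕ → ℕ) (θ₀ : EuclideanSpace ℝ (Fin N)) (Vt : S → ℝ) (t : ℕ) :
    Integrable (fun w => P.tnorm (P.value
      (P.iterate η n c (fun t i => X t i w) θ₀ t) - Vt)) μ := by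
  refine hX.integrable_of_finite_dependence
    ((Finset.range t).biUnion fun u => (Finset.range (n u)).image fun i => (u, i))
    (fun x => P.tnorm (P.value (P.iterate η n c x θ₀ t) - Vt)) fun x y h => ?_
  rw [iterate_congr η n c θ₀ t fun u hu i hi => h (u, i) ?_]
  simp only [Finset.mem_biUnion, Finset.mem_range, Finset.mem_image, Prod.mk.injEq]
  exact ⟨u, hu, i, hi, rfl, rfl⟩

omit [Fintype S] hP in
theorem _root_.FVI.IsIIDSample.integrable_freq_sub_sq [Finite S] {σ : S → ℝ} {Ω : Type*}
    [MeasurableSpace Ω] {μ : Measure Ω} [IsProbabilityMeasure μ] {X : ℕ → ℕ → Ω → S}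
    (hX : IsIIDSample σ μ X) (t n : ℕ) (s : S) :
    Integrable (fun w => (freq n (fun i => X t i w) s - σ s) ^ 2) μ := by
  refine hX.integrable_of_finite_dependence ((Finset.range n).image fun i => (t, i))
    (fun x => (freq n (x t) s - σ s) ^ 2) fun x y h => ?_
  have : freq n (x t) s = freq n (y t) s := by
    simp only [freq]
    congr 1
    refine Finset.sum_congr rfl fun i hi => ?_
    rw [h (t, i) (Finset.mem_image_of_mem _ hi)]
  simp only [this]

/-- Divided by `g ^ T`, the expected error grows by at most a constant per iteration. Compactness of
`Theta` gives an initial bound `U` uniform in `θ₀`. -/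
theorem exists_integral_tnorm_iterate_le [Fintype A] [Nonempty A] {ν δ' η ε₀ δ : ℝ} (hν : 0 < ν)
    (hδ' : 0 < δ') (hη : 0 < η) (hηM : η * M ≤ 1) (hε₀ : 0 < ε₀) (hε₀' : ε₀ < 1 / 4)
    (hδ : 0 < δ) {Vt : S → ℝ} (hVt : Vt ∈ P.values) (hfix : P.projBellman Vt = Vt) :
    ∃ U C : ℝ, ∀ (T : ℕ) (n c : ℕ → ℕ),
      (∀ t < T, 0 < n t ∧ P.sampleBound γ ν δ' (acc ε₀ δ t) ≤ n t ∧
          P.stepBound η (acc ε₀ δ t) ≤ c t) →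
      ∀ (Ω : Type*) [MeasurableSpace Ω] (μ : Measure Ω) [IsProbabilityMeasure μ]
          (X : ℕ → ℕ → Ω → S), IsIIDSample P.sigma μ X → ∀ θ₀ ∈ P.Theta,
        ∫ w, P.tnorm (P.value (P.iterate η n c (fun t i => X t i w) θ₀ T) - Vt) ∂μ ≤
          gammaStar γ δ ^ T * (U + C * T) := by
  obtain ⟨U, hU⟩ := hP.theta_compact.exists_bound_of_continuousOn
    (f := fun θ => P.tnorm (P.value θ - Vt))
    (hP.continuous_tnorm.comp_continuousOn (hP.continuousOn_value.sub continuousOn_const))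
  obtain ⟨b₀, hb₀, hb⟩ := hP.exists_sampleLoss_sub_le
  obtain ⟨C₀, hC₀, hC⟩ := hP.exists_lip_div_le hν hδ'
  set b := b₀ * (P.lipSup * P.diam) with hbdef
  have hbnn : 0 ≤ b := mul_nonneg hb₀ (mul_nonneg hP.lipSup_nonneg P.diam_nonneg)
  have hcpos := hP.cSigmaTau_pos
  set g := gammaStar γ δ
  have hg : 0 < g := gammaStar_pos hδ
  set m : ℝ := (Fintype.card S : ℝ)
  set C₁ := ((m * (b₀ * C₀ + b) / 2 + 1 / 2) / 2 + 1 / 2) / P.cSigmaTau with hC₁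
  have hm : 0 ≤ m := Nat.cast_nonneg _
  have hC₁nn : 0 ≤ C₁ := by positivity
  -- Division by `g` because the increment `C₁ * √ε₀ * g ^ T` enters at time `T + 1`.
  refine ⟨U, C₁ * √ε₀ / g, fun T n c => ?_⟩
  induction T with
  | zero =>
    intro _ Ω _ μ _ X _ θ₀ hθ₀
    have := (le_abs_self _).trans (hU θ₀ hθ₀)
    simpa [iterate] using this
  | succ T ih =>
    intro hnc Ω _ μ _ X hX θ₀ hθ₀
    have ih' := ih (fun t ht => hnc t (ht.trans (Nat.lt_succ_self T))) Ω μ X hX θ₀ hθ₀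
    obtain ⟨hn, hns, hcs⟩ := hnc T (Nat.lt_succ_self T)
    have he : 0 < acc ε₀ δ T := acc_pos hε₀ hδ T
    have he4 : acc ε₀ δ T < 1 / 4 := (acc_le hε₀ hδ T).trans_lt hε₀'
    have hsqrt := sqrt_acc (ε₀ := ε₀) hδ T
    set e := acc ε₀ δ T
    have he' : 0 < √e := Real.sqrt_pos.2 he
    set err : ℕ → Ω → ℝ := fun t w =>
      P.tnorm (P.value (P.iterate η n c (fun t i => X t i w) θ₀ t) - Vt)
    set d : S → Ω → ℝ := fun s w => (freq (n T) (fun i => X T i w) s - P.sigma s) ^ 2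
    have herr : ∀ t, Integrable (err t) μ := hX.integrable_tnorm_iterate η n c θ₀ Vt
    have hd : ∀ s, Integrable (d s) μ := hX.integrable_freq_sub_sq T (n T)
    have hdle : ∀ s, ∫ w, d s w ∂μ ≤ 1 / n T := hX.integral_freq_sub_sq_le T hn
    -- The constants are uniform over the current iterate, so the estimate holds for every outcome
    -- and no conditioning on past samples is needed.
    have hpath : ∀ w, err (T + 1) w ≤ γ * err T w +
        ((b * ∑ s, (d s w / (2 * e) + e / 2) + e / 2) / (2 * √e) + √e / 2) / P.cSigmaTau :=
      fun w => hP.tnorm_iterate_pgdStep_sub_le hVt hfix (hP.iterate_mem n c _ hθ₀ T) _ hbnn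
        (hb _ (hP.iterate_mem n c _ hθ₀ T)) hη hηM hn he hcs
    have hI1 : ∀ s, Integrable (fun w => d s w / (2 * e) + e / 2) μ := fun s =>
      ((hd s).div_const _).add (integrable_const _)
    have hI2 : Integrable (fun w => ∑ s, (d s w / (2 * e) + e / 2)) μ :=
      integrable_finsetSum _ fun s _ => hI1 s
    have hI3 : Integrable (fun w => b * ∑ s, (d s w / (2 * e) + e / 2) + e / 2) μ :=
      (hI2.const_mul b).add (integrable_const _)
    have hI4 : Integrable (fun w =>
        (b * ∑ s, (d s w / (2 * e) + e / 2) + e / 2) / (2 * √e) + √e / 2) μ :=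
      (hI3.div_const _).add (integrable_const _)
    have hint := integral_mono (herr (T + 1)) (((herr T).const_mul γ).add
      (hI4.div_const P.cSigmaTau)) hpath
    have hcalc : ∫ w, (γ * err T w + ((b * ∑ s, (d s w / (2 * e) + e / 2) + e / 2) /
          (2 * √e) + √e / 2) / P.cSigmaTau) ∂μ =
        γ * ∫ w, err T w ∂μ + ((b * ∑ s, ((∫ w, d s w ∂μ) / (2 * e) + e / 2) + e / 2) /
          (2 * √e) + √e / 2) / P.cSigmaTau := by
      rw [integral_add ((herr T).const_mul γ) (hI4.div_const _), integral_const_mul,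
        integral_div, integral_add (hI3.div_const _) (integrable_const _), integral_div,
        integral_add (hI2.const_mul b) (integrable_const _), integral_const_mul,
        integral_finsetSum _ fun s _ => hI1 s]
      simp only [integral_add ((hd _).div_const (2 * e)) (integrable_const (e / 2)),
        integral_div, integral_const, probReal_univ, one_smul]
    have hsum : b * ∑ s, ((∫ w, d s w ∂μ) / (2 * e) + e / 2) ≤ m * (b₀ * C₀ + b) / 2 * e := by
      calc b * ∑ s, ((∫ w, d s w ∂μ) / (2 * e) + e / 2)
          ≤ b * ∑ s : S, ((1 / (n T : ℝ)) / (2 * e) + e / 2) := by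
            gcongr with s
            exact hdle s
        _ = m * ((b₀ * (P.lipSup * P.diam * (1 / n T))) / (2 * e) + b * e / 2) := by
            rw [Finset.sum_const, Finset.card_univ, nsmul_eq_mul, hbdef]
            ring
        _ ≤ m * ((b₀ * (C₀ * e ^ 2)) / (2 * e) + b * e / 2) := by
            have := hC e he he4 (n T) hn hns
            generalize P.lipSup * P.diam * (1 / (n T : ℝ)) = q at this
            gcongr
        _ = _ := by
            field_simp
    have hstep : ((b * ∑ s, ((∫ w, d s w ∂μ) / (2 * e) + e / 2) + e / 2) /
          (2 * √e) + √e / 2) / P.cSigmaTau ≤ C₁ * √e := by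
      rw [hC₁, div_mul_eq_mul_div]
      refine div_le_div_of_nonneg_right ?_ hcpos.le
      have h1 : (b * ∑ s, ((∫ w, d s w ∂μ) / (2 * e) + e / 2) + e / 2) / (2 * √e) ≤
          ((m * (b₀ * C₀ + b) / 2 + 1 / 2) * e) / (2 * √e) := by
        refine div_le_div_of_nonneg_right ?_ (by positivity)
        linarith
      have h2 : ((m * (b₀ * C₀ + b) / 2 + 1 / 2) * e) / (2 * √e) =
          (m * (b₀ * C₀ + b) / 2 + 1 / 2) / 2 * √e := by
        rw [div_eq_iff (by positivity)]
        nth_rewrite 1 [← Real.mul_self_sqrt he.le]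
        ring
      linarith
    have hq : √e ≤ √ε₀ * g ^ T := by
      rw [hsqrt]
      gcongr
      exact le_max_right _ _
    have hE : 0 ≤ ∫ w, err T w ∂μ := integral_nonneg fun w => hP.tnorm_nonneg _
    have hγg : γ ≤ g := le_max_left _ _
    have hfin : γ * ∫ w, err T w ∂μ ≤ g * (g ^ T * (U + C₁ * √ε₀ / g * T)) :=
      mul_le_mul hγg ih' hE hg.le
    have hfin2 : C₁ * √e ≤ C₁ * (√ε₀ * g ^ T) := by gcongr
    calc ∫ w, err (T + 1) w ∂μ ≤ g * (g ^ T * (U + C₁ * √ε₀ / g * T)) +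
          C₁ * (√ε₀ * g ^ T) := by
          refine hint.trans (hcalc.le.trans ?_)
          linarith
      _ = _ := by
          push_cast
          field_simp
          ring

end Standing

end Problem

end FVI

namespace FVI

/-! ### Rates and complexity -/

section Rates

variable {γ δ X ε : ℝ}

/-- By definition `a * logb (1 + δ) γ* = -2`, which produces the square; rounding up only helps
because `γ* < 1`. -/
theorem gammaStar_pow_ceil_le (hγ : γ < 1) (hδ : 0 < δ) (hX : 0 < X) (hε : 0 < ε) :
    gammaStar γ δ ^ ⌈expo γ δ * Real.logb (1 + δ) (X / ε)⌉₊ ≤ (ε / X) ^ 2 := by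
  have hg := gammaStar_pos (γ := γ) hδ
  have hg1 := gammaStar_lt_one hγ hδ
  have h1 : (1 : ℝ) < 1 + δ := by linarith
  have hlog := Real.logb_neg h1 hg hg1
  rw [← Real.rpow_natCast]
  refine (Real.rpow_le_rpow_of_exponent_ge hg hg1.le (Nat.le_ceil _)).trans_eq ?_
  nth_rewrite 1 [← Real.rpow_logb (by linarith) h1.ne' hg]
  rw [← Real.rpow_mul (by linarith)]
  have h2 : Real.logb (1 + δ) (gammaStar γ δ) * (expo γ δ * Real.logb (1 + δ) (X / ε)) =
      Real.logb (1 + δ) (X / ε) * (-2) := by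
    have hne := hlog.ne
    rw [expo]
    field_simp
  rw [h2, Real.rpow_mul (by linarith), Real.rpow_logb (by linarith) h1.ne' (by positivity),
    Real.rpow_neg (by positivity), ← Real.inv_rpow (by positivity), inv_div]
  exact Real.rpow_natCast _ 2

theorem ceil_le (hγ : γ < 1) (hδ : 0 < δ) (hε : 0 < ε) (hεX : ε ≤ X) :
    (⌈expo γ δ * Real.logb (1 + δ) (X / ε)⌉₊ : ℝ) ≤
      expo γ δ * Real.logb (1 + δ) (X / ε) + 1 := by
  refine (Nat.ceil_lt_add_one (mul_nonneg (expo_pos hγ hδ).le ?_)).le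
  exact Real.logb_nonneg (by linarith) ((one_le_div hε).2 hεX)

theorem pow_ceil_le (hγ : γ < 1) (hδ : 0 < δ) (hε : 0 < ε) (hεX : ε ≤ X) :
    (1 + δ) ^ ⌈expo γ δ * Real.logb (1 + δ) (X / ε)⌉₊ ≤
      (1 + δ) * X ^ expo γ δ * (1 / ε) ^ expo γ δ := by
  have hX : 0 < X := hε.trans_le hεX
  have h1 : (1 : ℝ) < 1 + δ := by linarith
  rw [← Real.rpow_natCast]
  refine (Real.rpow_le_rpow_of_exponent_le h1.le (ceil_le hγ hδ hε hεX)).trans_eq ?_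
  rw [Real.rpow_add_one (by linarith), mul_comm (expo γ δ), Real.rpow_mul (by linarith),
    Real.rpow_logb (by linarith) h1.ne' (by positivity), div_eq_mul_one_div,
    Real.mul_rpow hX.le (by positivity)]
  ring

/-- With `y = X / ε`, the power is at most `y⁻²` while the bracket is `O(1 + log y) = o(y)`. -/
theorem eventually_gammaStar_pow_mul_lt (hγ : γ < 1) (hδ : 0 < δ) (hX : 0 < X) (U C : ℝ) :
    ∃ ε₁ > 0, ∀ ε, 0 < ε → ε < ε₁ →
      gammaStar γ δ ^ ⌈expo γ δ * Real.logb (1 + δ) (X / ε)⌉₊ *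
        (U + C * ⌈expo γ δ * Real.logb (1 + δ) (X / ε)⌉₊) < ε := by
  have ha := expo_pos hγ hδ
  set a := expo γ δ
  have hlo : (fun y : ℝ => (|U| + |C|) + |C| * (a * Real.logb (1 + δ) y)) =o[atTop] id := by
    refine (Asymptotics.isLittleO_const_id_atTop _).add ?_
    have h := Real.isLittleO_log_id_atTop.const_mul_left (|C| * (a * (Real.log (1 + δ))⁻¹))
    refine h.congr_left fun y => ?_
    rw [Real.logb]
    ring
  -- The constant `X / 2` is chosen so that the final product is `ε / 2`.
  have hev := (hlo.bound (half_pos hX)).and (eventually_gt_atTop 0)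
  obtain ⟨y₀, hy₀⟩ := eventually_atTop.1 hev
  refine ⟨min X (X / max y₀ 1), by positivity, fun ε hε hlt => ?_⟩
  have hεX : ε ≤ X := hlt.le.trans (min_le_left _ _)
  have hy : y₀ ≤ X / ε := by
    have h1 : ε < X / max y₀ 1 := hlt.trans_le (min_le_right _ _)
    rw [lt_div_iff₀ (by positivity)] at h1
    rw [le_div_iff₀ hε]
    exact (mul_le_mul_of_nonneg_right (le_max_left y₀ 1) hε.le).trans (by linarith)
  obtain ⟨h1, hpos⟩ := hy₀ _ hy
  rw [id, Real.norm_of_nonneg hpos.le] at h1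
  have h2 := (le_abs_self _).trans h1
  have hceil := ceil_le hγ hδ hε hεX
  have hpow := gammaStar_pow_ceil_le hγ hδ hX hε
  set T := ⌈a * Real.logb (1 + δ) (X / ε)⌉₊
  have h3 : U + C * T ≤ (|U| + |C|) + |C| * (a * Real.logb (1 + δ) (X / ε)) := by
    have h4 : C * T ≤ |C| * (a * Real.logb (1 + δ) (X / ε) + 1) :=
      mul_le_mul (le_abs_self C) hceil (Nat.cast_nonneg _) (abs_nonneg _)
    linarith [le_abs_self U]
  have hg := gammaStar_pos (γ := γ) hδ
  calc gammaStar γ δ ^ T * (U + C * T) ≤ gammaStar γ δ ^ T * (X / 2 * (X / ε)) := by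
        gcongr
        exact h3.trans h2
    _ ≤ (ε / X) ^ 2 * (X / 2 * (X / ε)) := by gcongr
    _ = ε / 2 := by field_simp
    _ < ε := half_lt_self hε

theorem sum_range_pow_le {r : ℝ} (hr : 1 < r) (T : ℕ) :
    ∑ t ∈ Finset.range T, r ^ t ≤ r ^ T / (r - 1) := by
  rw [le_div_iff₀ (by linarith), geom_sum_mul]
  linarith

end Rates

namespace Problem

variable {S A : Type*} [Fintype S] {K N : ℕ} (P : Problem S A K N)

/-- `1 / ε_t ^ 2` is geometric of ratio `(1 + δ) ^ 2`, and the logarithms are at most affine in `t`.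
The added 1 covers rounding. -/
theorem exists_sampleBound_acc_le (γ ν δ' : ℝ) {ε₀ δ : ℝ} (hε₀ : 0 < ε₀) (hδ : 0 < δ) :
    ∃ C : ℝ, 0 ≤ C ∧ ∀ t : ℕ, P.sampleBound γ ν δ' (acc ε₀ δ t) + 1 ≤
      C * ((t + 1) * ((1 + δ) ^ 2) ^ t) := by
  set β := 16 * ν * P.diam * (P.kappaStar γ + δ') with hβ
  set l := Real.log (1 + δ)
  have hl : 0 ≤ l := Real.log_nonneg (by linarith)
  set G := N * (|Real.log β| + |Real.log ε₀| + l) + 1 / 2 * (|Real.log ε₀| + l)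
  have hG : 0 ≤ G := by positivity
  set B := 32 * P.omega γ ^ 2 / ε₀ ^ 2
  have hB : 0 ≤ B := by positivity
  refine ⟨B * G + 1, by positivity, fun t => ?_⟩
  have hacc := acc_pos hε₀ hδ t
  have hlogacc : |Real.log (acc ε₀ δ t)| ≤ |Real.log ε₀| + t * l := by
    rw [acc, Real.log_div hε₀.ne' (by positivity), Real.log_pow]
    refine (abs_sub _ _).trans_eq ?_
    rw [abs_of_nonneg (mul_nonneg (Nat.cast_nonneg t) hl)]
  have hlogβ : Real.log (β / acc ε₀ δ t) ≤ |Real.log β| + |Real.log (acc ε₀ δ t)| := by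
    -- No sign of `β` is assumed; `log` of a quotient splits whenever `β ≠ 0`, and `Real.log 0 = 0`
    -- settles the other case.
    by_cases h0 : β = 0
    · simp only [h0, zero_div, Real.log_zero]
      positivity
    · rw [Real.log_div h0 hacc.ne']
      exact (le_abs_self _).trans (abs_sub _ _)
  have hlog1 : Real.log (1 / acc ε₀ δ t) ≤ |Real.log (acc ε₀ δ t)| := by
    rw [one_div, Real.log_inv]
    exact neg_le_abs _
  have hbr : N * Real.log (β / acc ε₀ δ t) + 1 / 2 * Real.log (1 / acc ε₀ δ t) ≤ G * (t + 1) := by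
    have ht : (0 : ℝ) ≤ t := Nat.cast_nonneg t
    calc _ ≤ N * (|Real.log β| + (|Real.log ε₀| + t * l)) + 1 / 2 * (|Real.log ε₀| + t * l) := by
          gcongr
          · exact hlogβ.trans (by linarith)
          · exact hlog1.trans hlogacc
      _ ≤ G * (t + 1) := by
          have h1 : 0 ≤ N * (l + t * (|Real.log β| + |Real.log ε₀|)) +
            1 / 2 * (l + t * |Real.log ε₀|) := by positivity
          have h2 : G * (t + 1) = N * (|Real.log β| + (|Real.log ε₀| + t * l)) +
            1 / 2 * (|Real.log ε₀| + t * l) + (N * (l + t * (|Real.log β| + |Real.log ε₀|)) +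
            1 / 2 * (l + t * |Real.log ε₀|)) := by ring
          linarith
  have hcoef : 32 * P.omega γ ^ 2 / acc ε₀ δ t ^ 2 = B * ((1 + δ) ^ 2) ^ t := by
    simp only [acc, B]
    rw [div_pow, ← pow_mul, ← pow_mul, mul_comm t 2]
    field_simp
  have hr : (1 : ℝ) ≤ ((1 + δ) ^ 2) ^ t := one_le_pow₀ (one_le_pow₀ (by linarith))
  have hone : (1 : ℝ) ≤ (t + 1) * ((1 + δ) ^ 2) ^ t :=
    one_le_mul_of_one_le_of_one_le (by linarith [Nat.cast_nonneg (α := ℝ) t]) hr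
  have hmain : P.sampleBound γ ν δ' (acc ε₀ δ t) ≤ B * G * ((t + 1) * ((1 + δ) ^ 2) ^ t) := by
    refine max_le ?_ (by positivity)
    rw [← hβ, hcoef]
    calc _ ≤ B * ((1 + δ) ^ 2) ^ t * (G * (t + 1)) := by gcongr
      _ = _ := by ring
  linarith

/-- The factor `t + 1 ≤ T` yields the logarithm, and the geometric sum is of order `(1 + δ) ^ (2 *
T)`, which yields the exponent `2 * a`. -/
theorem exists_sum_sample_le {γ ε₀ δ : ℝ} (ν δ' : ℝ) (hγ : γ < 1) (hε₀ : 0 < ε₀) (hδ : 0 < δ)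
    (hX : 0 < P.rho + P.rho' γ ε₀) :
    ∃ C : ℝ, ∀ ε, 0 < ε → ε < 1 / (1 + δ) → ε ≤ P.rho + P.rho' γ ε₀ → ∀ n : ℕ → ℕ,
      (∀ t < P.numIter γ ε₀ δ ε, (n t : ℝ) ≤ P.sampleBound γ ν δ' (acc ε₀ δ t) + 1) →
        ∑ t ∈ Finset.range (P.numIter γ ε₀ δ ε), (n t : ℝ) ≤
          C * (Real.logb (1 + δ) (1 / ε) * (1 / ε) ^ (2 * expo γ δ)) := by
  obtain ⟨B, hB, hbound⟩ := P.exists_sampleBound_acc_le γ ν δ' hε₀ hδ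
  have ha := expo_pos hγ hδ
  set a := expo γ δ with hadef
  set X := P.rho + P.rho' γ ε₀ with hXdef
  set r := (1 + δ) ^ 2 with hr
  have hr1 : 1 < r := one_lt_pow₀ (by linarith) two_ne_zero
  have hr1' : 0 < r - 1 := by linarith
  set l := |Real.logb (1 + δ) X|
  refine ⟨B * ((a * l + a + 1) * (((1 + δ) * X ^ a) ^ 2 / (r - 1))),
    fun ε hε hε1 hεX n hn => ?_⟩
  have hT := ceil_le (γ := γ) hγ hδ hε hεX
  have hpow := pow_ceil_le (γ := γ) hγ hδ hε hεX
  rw [← hadef] at hT hpow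
  change (P.numIter γ ε₀ δ ε : ℝ) ≤ _ at hT
  change (1 + δ) ^ P.numIter γ ε₀ δ ε ≤ _ at hpow
  set T := P.numIter γ ε₀ δ ε
  set L := Real.logb (1 + δ) (1 / ε) with hL
  -- Ensured by `ε < 1 / (1 + δ)`; it lets additive constants be absorbed into multiples of `L`.
  have hL1 : 1 ≤ L := by
    rw [hL, Real.le_logb_iff_rpow_le (by linarith) (by positivity), Real.rpow_one,
      le_div_iff₀ hε]
    rw [lt_div_iff₀ (by linarith)] at hε1
    linarith
  have hTL : (T : ℝ) ≤ (a * l + a + 1) * L := by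
    have h1 : Real.logb (1 + δ) (X / ε) ≤ l + L := by
      rw [div_eq_mul_one_div, Real.logb_mul hX.ne' (by positivity)]
      linarith [le_abs_self (Real.logb (1 + δ) X)]
    have h2 : a * Real.logb (1 + δ) (X / ε) ≤ a * (l + L) := by gcongr
    have h3 : a * l ≤ a * l * L := le_mul_of_one_le_right (by positivity) hL1
    linarith
  have hrT : r ^ T ≤ ((1 + δ) * X ^ a) ^ 2 * (1 / ε) ^ (2 * a) := by
    have h1 : r ^ T = ((1 + δ) ^ T) ^ 2 := by rw [hr, ← pow_mul, ← pow_mul, mul_comm]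
    have h2 : (1 / ε) ^ (2 * a) = ((1 / ε) ^ a) ^ 2 := by
      rw [mul_comm, Real.rpow_mul (by positivity)]
      exact Real.rpow_natCast _ 2
    rw [h1, h2, ← mul_pow]
    gcongr
  calc ∑ t ∈ Finset.range T, (n t : ℝ) ≤ ∑ t ∈ Finset.range T, B * (T * r ^ t) := by
        refine Finset.sum_le_sum fun t ht => ?_
        have ht' := Finset.mem_range.1 ht
        refine (hn t ht').trans ((hbound t).trans ?_)
        gcongr
        exact_mod_cast ht'
    _ = B * (T * ∑ t ∈ Finset.range T, r ^ t) := by rw [← Finset.mul_sum, ← Finset.mul_sum]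
    _ ≤ B * (((a * l + a + 1) * L) *
        ((((1 + δ) * X ^ a) ^ 2 * (1 / ε) ^ (2 * a)) / (r - 1))) := by
        gcongr
        exact (sum_range_pow_le hr1 T).trans (by gcongr)
    _ = _ := by ring

theorem exists_sum_step_le {γ ε₀ δ η : ℝ} (hγ : γ < 1) (hε₀ : 0 < ε₀) (hδ : 0 < δ) (hη : 0 < η) :
    ∃ C : ℝ, ∀ ε, 0 < ε → ε ≤ P.rho + P.rho' γ ε₀ → ∀ c : ℕ → ℕ,
      (∀ t < P.numIter γ ε₀ δ ε, (c t : ℝ) ≤ P.stepBound η (acc ε₀ δ t) + 1) →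
        ∑ t ∈ Finset.range (P.numIter γ ε₀ δ ε), (c t : ℝ) ≤ C * (1 / ε) ^ expo γ δ := by
  set a := expo γ δ with hadef
  set X := P.rho + P.rho' γ ε₀ with hXdef
  set B := P.diam ^ 2 / (η * ε₀) + 1
  have hB : 0 ≤ B := by positivity
  refine ⟨B * ((1 + δ) * X ^ a / δ), fun ε hε hεX c hc => ?_⟩
  have hpow := pow_ceil_le (γ := γ) hγ hδ hε hεX
  rw [← hadef] at hpow
  change (1 + δ) ^ P.numIter γ ε₀ δ ε ≤ _ at hpow
  set T := P.numIter γ ε₀ δ ε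
  calc ∑ t ∈ Finset.range T, (c t : ℝ) ≤ ∑ t ∈ Finset.range T, B * (1 + δ) ^ t := by
        refine Finset.sum_le_sum fun t ht => (hc t (Finset.mem_range.1 ht)).trans ?_
        have h1 : P.stepBound η (acc ε₀ δ t) = P.diam ^ 2 / (η * ε₀) * (1 + δ) ^ t := by
          simp only [stepBound, acc]
          field_simp
        have h2 : (1 : ℝ) ≤ (1 + δ) ^ t := one_le_pow₀ (by linarith)
        rw [h1, add_one_mul]
        linarith
    _ = B * ∑ t ∈ Finset.range T, (1 + δ) ^ t := by rw [← Finset.mul_sum]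
    _ ≤ B * (((1 + δ) * X ^ a * (1 / ε) ^ a) / δ) := by
        gcongr
        refine (sum_range_pow_le (by linarith : 1 < 1 + δ) T).trans ?_
        rw [add_sub_cancel_left]
        gcongr
    _ = _ := by ring

end Problem

end FVI

/-! ### The main theorem -/

theorem mainTheorem11 {S A : Type*} [Fintype S] [MeasurableSpace S] [MeasurableSingletonClass S]
    [Fintype A] [Nonempty A] {K N : ℕ} (P : FVI.Problem S A K N)
    (γ M ν δ' η ε₀ δ : ℝ) (hP : P.Standing γ M) (hν : P.IsCoveringConst ν) (hδ' : 0 < δ')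
    (hη : 0 < η) (hηκ : η * P.kappaStar γ ≤ 1) (hηM : η * M ≤ 1)
    (hε₀ : 0 < ε₀) (hε₀' : ε₀ < 1 / 4) (hδ : 0 < δ) :
    FVI.gammaStar γ δ < 1 ∧ 0 < FVI.expo γ δ ∧
    ∃ Vt : S → ℝ, P.IsPVILimit Vt ∧
    ∃ ε₁ C₁ C₂ : ℝ, 0 < ε₁ ∧ ε₁ < 1 ∧ ∀ ε : ℝ, 0 < ε → ε < ε₁ → ∀ n c : ℕ → ℕ,
      (∀ t < P.numIter γ ε₀ δ ε,
        0 < n t ∧ P.sampleBound γ ν δ' (FVI.acc ε₀ δ t) ≤ n t ∧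
          P.stepBound η (FVI.acc ε₀ δ t) ≤ c t) →
      (∀ (Ω : Type*) [MeasurableSpace Ω] (μ : Measure Ω) [IsProbabilityMeasure μ]
          (X : ℕ → ℕ → Ω → S), FVI.IsIIDSample P.sigma μ X →
        ∀ θ₀ ∈ P.Theta, P.tnorm (P.value θ₀) ≤ P.rho →
          Integrable (fun w => P.tnorm (P.value
            (P.iterate η n c (fun t i => X t i w) θ₀ (P.numIter γ ε₀ δ ε)) - Vt)) μ ∧
          ∫ w, P.tnorm (P.value
            (P.iterate η n c (fun t i => X t i w) θ₀ (P.numIter γ ε₀ δ ε)) - Vt) ∂μ < ε) ∧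
      ((∀ t < P.numIter γ ε₀ δ ε, (n t : ℝ) ≤ P.sampleBound γ ν δ' (FVI.acc ε₀ δ t) + 1) →
        (∑ t ∈ Finset.range (P.numIter γ ε₀ δ ε), (n t : ℝ)) ≤
          C₁ * (Real.logb (1 + δ) (1 / ε) * (1 / ε) ^ (2 * FVI.expo γ δ))) ∧
      ((∀ t < P.numIter γ ε₀ δ ε, (c t : ℝ) ≤ P.stepBound η (FVI.acc ε₀ δ t) + 1) →
        (∑ t ∈ Finset.range (P.numIter γ ε₀ δ ε), (c t : ℝ)) ≤
          C₂ * (1 / ε) ^ FVI.expo γ δ) := by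
  have hγ := hP.gamma_lt_one
  refine ⟨FVI.gammaStar_lt_one hγ hδ, FVI.expo_pos hγ hδ, ?_⟩
  obtain ⟨Vt, hlim, hfix⟩ := hP.exists_isPVILimit
  refine ⟨Vt, hlim, ?_⟩
  have hX : 0 < P.rho + P.rho' γ ε₀ := add_pos_of_nonneg_of_pos hP.rho_nonneg (hP.rho'_pos hε₀)
  obtain ⟨U, C, hUC⟩ := hP.exists_integral_tnorm_iterate_le hν.1 hδ' hη hηM hε₀ hε₀' hδ hlim.1 hfix
  obtain ⟨ε₂, hε₂, hsmall⟩ := FVI.eventually_gammaStar_pow_mul_lt hγ hδ hX U C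
  obtain ⟨C₁, hC₁⟩ := P.exists_sum_sample_le ν δ' hγ hε₀ hδ hX
  obtain ⟨C₂, hC₂⟩ := P.exists_sum_step_le (γ := γ) hγ hε₀ hδ hη
  -- `ε₂` serves the expectation bound, `1 / (1 + δ)` gives `ε₁ < 1` and a logarithm of at least 1,
  -- and `ρ + ρ'` keeps the argument of the ceiling nonnegative.
  refine ⟨min ε₂ (min (1 / (1 + δ)) (P.rho + P.rho' γ ε₀)), C₁, C₂, by positivity, ?_,
    fun ε hε hlt n c hnc => ?_⟩
  · refine (min_le_right _ _).trans_lt ((min_le_left _ _).trans_lt ?_)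
    rw [div_lt_one (by linarith)]
    linarith
  · rw [lt_min_iff, lt_min_iff] at hlt
    obtain ⟨hlt₂, hltδ, hltX⟩ := hlt
    refine ⟨fun Ω _ μ _ X hXs θ₀ hθ₀ _ => ⟨hXs.integrable_tnorm_iterate η n c θ₀ Vt _, ?_⟩,
      hC₁ ε hε hltδ hltX.le n, hC₂ ε hε hltX.le c⟩
    exact (hUC _ n c hnc Ω μ X hXs θ₀ hθ₀).trans_lt (hsmall ε hε hlt₂)
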